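/- Let $c_{00}$ be the space of finitely supported real sequences and $\|u\|_1=\sum_j|u(j)|$. A map $\Phi:c_{00}\to\mathbb R$ is called quasilinear if $\Phi(\alpha u)=\alpha\,\Phi(u)$ for all $\alpha\in\mathbb R$, $u\in c_{00}$, and if there is a constant $\delta$ with $|\Phi(u)+\Phi(v)-\Phi(u+v)|\le\delta(\|u\|_1+\|v\|_1)$ for all $u,v\in c_{00}$. Given such a $\Phi$, let $Y=\mathbb R\oplus_\Phi\ell_1$ be the completion of the vector space $\mathbb R\oplus c_{00}$ under the quasinorm $\|(\alpha,u)\|_\Phi=|\alpha-\Phi(u)|+\|u\|_1$, let $e_0=(1,0)\in Y$, and let $\pi:Y\to\ell_1$ be the quotient map, i.e. the continuous linear extension of $(\alpha,u)\mapsto u$. Theorem. Let $\Phi:c_{00}\to\mathbb R$ be a quasilinear map and let $Y=\mathbb R\oplus_\Phi\ell_1$. The following conditions are equivalent: (1) $Y$ contains no basic sequence, i.e. no sequence that is a Schauder basis of its closed linear span; (2) every infinite-dimensional closed linear subspace of $Y$ contains $e_0$; (3) the quotient map $\pi:Y\to\ell_1$ is strictly singular, i.e. it is not an isomorphism onto its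 image on any infinite-dimensional closed subspace of $Y$; (4) $Y$ is topologically minimal, i.e. there is no strictly weaker Hausdorff vector topology on $Y$; (5) there is no infinite-dimensional linear subspace $F$ of $c_{00}$ for which there is a constant $K$ with $|\Phi(u)|\le K\|u\|_1$ for all $u\in F$; (6) every bounded linear operator $T:\ell_1\to Y$ is compact; (7) every bounded linear operator $T:Y\to Y$ has the form $T=\lambda I+S$ with $\lambda\in\mathbb R$ and $S:Y\to Y$ compact. -/

import Mathlib

open Filter Topology

noncomputable section

/-- The `ℓ₁`-norm of a finitely supported real sequence. -/
def l1Norm (u : ℕ →₀ ℝ) : ℝ := ∑ i ∈ u.support, |u i|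

/-- A quasilinear map on `c₀₀`, the space of finitely supported real sequences:
a homogeneous map `Φ : c₀₀ → ℝ` for which there is a constant `δ` with
`|Φ u + Φ v - Φ (u + v)| ≤ δ (‖u‖₁ + ‖v‖₁)` for all `u`, `v`. -/
structure QuasilinearMap where
  toFun : (ℕ →₀ ℝ) → ℝ
  map_smul' : ∀ (c : ℝ) (u : ℕ →₀ ℝ), toFun (c • u) = c * toFun u
  quasi_add' : ∃ δ : ℝ, ∀ u v : ℕ →₀ ℝ,
    |toFun u + toFun v - toFun (u + v)| ≤ δ * (l1Norm u + l1Norm v)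

instance : CoeFun QuasilinearMap (fun _ => (ℕ →₀ ℝ) → ℝ) := ⟨QuasilinearMap.toFun⟩

/-! ### The `ℓ₁`-norm and the inclusion of `c₀₀` in `ℓ₁` -/

/-- The Banach space `ℓ₁` of absolutely summable real sequences. -/
abbrev L1 : Type := lp (fun _ : ℕ => ℝ) 1

/-- The inclusion of `c₀₀` in `ℓ₁`. -/
def c00ToL1 : (ℕ →₀ ℝ) →ₗ[ℝ] L1 where
  toFun u := ⟨fun i => u i, (memℓp_zero (u.hasFiniteSupport.subset fun i hi => by
    simpa using hi)).of_exponent_ge (by simp)⟩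
  map_add' u v := by ext i; rfl
  map_smul' c u := by ext i; rfl

@[simp] theorem c00ToL1_apply (u : ℕ →₀ ℝ) (i : ℕ) : (c00ToL1 u : ℕ → ℝ) i = u i := rfl

theorem norm_c00ToL1 (u : ℕ →₀ ℝ) : ‖c00ToL1 u‖ = l1Norm u := by
  have h := lp.norm_rpow_eq_tsum (p := 1) (by simp) (c00ToL1 u)
  simp only [ENNReal.toReal_one, Real.rpow_one, c00ToL1_apply, Real.norm_eq_abs] at h
  rw [h, l1Norm]
  exact tsum_eq_sum fun i hi => by simpa using hi

theorem l1Norm_nonneg (u : ℕ →₀ ℝ) : 0 ≤ l1Norm u :=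
  Finset.sum_nonneg fun _ _ => abs_nonneg _

theorem l1Norm_add_le (u v : ℕ →₀ ℝ) : l1Norm (u + v) ≤ l1Norm u + l1Norm v := by
  simpa only [← norm_c00ToL1, map_add] using norm_add_le (c00ToL1 u) (c00ToL1 v)

theorem l1Norm_smul (c : ℝ) (u : ℕ →₀ ℝ) : l1Norm (c • u) = |c| * l1Norm u := by
  simp only [← norm_c00ToL1, map_smul, norm_smul, Real.norm_eq_abs]

/-! ### The twisted sum `ℝ ⊕_Φ ℓ₁` -/

/-- The vector space `ℝ ⊕ c₀₀`, which will carry the quasinorm determined by `Φ`. -/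
def PreTwistedSum (_Φ : QuasilinearMap) : Type := ℝ × (ℕ →₀ ℝ)

namespace PreTwistedSum

variable (Φ : QuasilinearMap)

instance : AddCommGroup (PreTwistedSum Φ) := inferInstanceAs (AddCommGroup (ℝ × (ℕ →₀ ℝ)))

instance : Module ℝ (PreTwistedSum Φ) := inferInstanceAs (Module ℝ (ℝ × (ℕ →₀ ℝ)))

/-- The identification of the underlying vector space with `ℝ ⊕ c₀₀`. -/
def toProd : PreTwistedSum Φ ≃ₗ[ℝ] ℝ × (ℕ →₀ ℝ) :=
  LinearEquiv.refl ℝ (ℝ × (ℕ →₀ ℝ))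

/-- The quasinorm `‖(α, u)‖_Φ = |α - Φ u| + ‖u‖₁`. -/
def qnorm (x : PreTwistedSum Φ) : ℝ :=
  |(toProd Φ x).1 - Φ (toProd Φ x).2| + l1Norm (toProd Φ x).2

theorem qnorm_smul (c : ℝ) (x : PreTwistedSum Φ) : qnorm Φ (c • x) = |c| * qnorm Φ x := by
  rw [qnorm, qnorm, map_smul, Prod.smul_fst, Prod.smul_snd, smul_eq_mul, Φ.map_smul', l1Norm_smul, ← mul_sub, abs_mul, mul_add]

theorem qnorm_nonneg (x : PreTwistedSum Φ) : 0 ≤ qnorm Φ x :=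
  add_nonneg (abs_nonneg _) (l1Norm_nonneg _)

theorem exists_qnorm_add_le : ∃ C : ℝ, 1 ≤ C ∧
    ∀ x y : PreTwistedSum Φ, qnorm Φ (x + y) ≤ C * (qnorm Φ x + qnorm Φ y) := by
  obtain ⟨δ, hδ⟩ := Φ.quasi_add'
  refine ⟨1 + |δ|, by simp, fun x y => ?_⟩
  set a := toProd Φ x
  set b := toProd Φ y
  have hs : 0 ≤ l1Norm a.2 + l1Norm b.2 := add_nonneg (l1Norm_nonneg _) (l1Norm_nonneg _)
  have hd := (hδ a.2 b.2).trans (mul_le_mul_of_nonneg_right (le_abs_self δ) hs)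
  have ht : |a.1 + b.1 - Φ (a.2 + b.2)| ≤
      |a.1 - Φ a.2| + |b.1 - Φ b.2| + |Φ a.2 + Φ b.2 - Φ (a.2 + b.2)| := by
    have : a.1 + b.1 - Φ (a.2 + b.2) =
      (a.1 - Φ a.2) + (b.1 - Φ b.2) + (Φ a.2 + Φ b.2 - Φ (a.2 + b.2)) := by ring
    rw [this]
    exact abs_add_three _ _ _
  have hl := l1Norm_add_le a.2 b.2
  have hp : 0 ≤ |δ| * (|a.1 - Φ a.2| + |b.1 - Φ b.2|) := by positivity
  rw [qnorm, qnorm, qnorm, map_add, Prod.fst_add, Prod.snd_add]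
  nlinarith

/-- The quasinorm balls `{x | ‖x‖_Φ < ε}`, `ε > 0`, as a basis of neighbourhoods of `0`. -/
def filterBasis : ModuleFilterBasis ℝ (PreTwistedSum Φ) where
  sets := {U | ∃ ε : ℝ, 0 < ε ∧ U = {x | qnorm Φ x < ε}}
  nonempty := ⟨_, 1, one_pos, rfl⟩
  inter_sets := by
    rintro _ _ ⟨ε, hε, rfl⟩ ⟨η, hη, rfl⟩
    exact ⟨_, ⟨min ε η, lt_min hε hη, rfl⟩, fun x (hx : qnorm Φ x < min ε η) => lt_min_iff.1 hx⟩
  zero' := by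
    rintro _ ⟨ε, hε, rfl⟩
    have := qnorm_smul Φ 0 0
    simp only [zero_smul, abs_zero, zero_mul] at this
    simpa [this] using hε
  add' := by
    rintro _ ⟨ε, hε, rfl⟩
    obtain ⟨C, hC, h⟩ := exists_qnorm_add_le Φ
    have hC0 : 0 < C := lt_of_lt_of_le one_pos hC
    refine ⟨_, ⟨ε / (2 * C), by positivity, rfl⟩, ?_⟩
    rintro _ ⟨x, hx, y, hy, rfl⟩
    have hx' : qnorm Φ x < ε / (2 * C) := hx
    have hy' : qnorm Φ y < ε / (2 * C) := hy
    calc qnorm Φ (x + y) ≤ C * (qnorm Φ x + qnorm Φ y) := h x y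
      _ < C * (ε / (2 * C) + ε / (2 * C)) := by gcongr
      _ = ε := by field_simp; ring
  neg' := by
    rintro _ ⟨ε, hε, rfl⟩
    refine ⟨_, ⟨ε, hε, rfl⟩, fun x hx => ?_⟩
    have := qnorm_smul Φ (-1) x
    simp only [neg_smul, one_smul, abs_neg, abs_one, one_mul] at this
    simpa [this] using hx
  conj' := by
    rintro x₀ _ ⟨ε, hε, rfl⟩
    exact ⟨_, ⟨ε, hε, rfl⟩, fun x hx => by simpa using hx⟩
  smul' := by
    rintro _ ⟨ε, hε, rfl⟩
    refine ⟨Metric.ball 0 1, Metric.ball_mem_nhds 0 one_pos, _, ⟨ε, hε, rfl⟩, ?_⟩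
    rintro _ ⟨c, hc, x, hx, rfl⟩
    have hc' : |c| < 1 := by simpa using hc
    have hx' : qnorm Φ x < ε := hx
    have := qnorm_smul Φ c x
    have h0 := qnorm_nonneg Φ x
    change qnorm Φ (c • x) < ε
    nlinarith
  smul_left' := by
    rintro c _ ⟨ε, hε, rfl⟩
    refine ⟨_, ⟨ε / (|c| + 1), by positivity, rfl⟩, fun x hx => ?_⟩
    have hx' : qnorm Φ x < ε / (|c| + 1) := hx
    have := qnorm_smul Φ c x
    have h0 := qnorm_nonneg Φ x
    rw [lt_div_iff₀ (by positivity)] at hx'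
    change qnorm Φ (c • x) < ε
    nlinarith
  smul_right' := by
    rintro x _ ⟨ε, hε, rfl⟩
    have h : Tendsto (fun c : ℝ => |c| * qnorm Φ x) (𝓝 0) (𝓝 0) := by
      have : Continuous fun c : ℝ => |c| * qnorm Φ x := by fun_prop
      simpa using this.tendsto 0
    filter_upwards [h.eventually (gt_mem_nhds hε)] with c hc
    change qnorm Φ (c • x) < ε
    rwa [qnorm_smul]

/-- The vector topology of the quasinorm. -/
instance : TopologicalSpace (PreTwistedSum Φ) := (filterBasis Φ).topology

instance : IsTopologicalAddGroup (PreTwistedSum Φ) :=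
  (filterBasis Φ).toAddGroupFilterBasis.isTopologicalAddGroup

instance : ContinuousSMul ℝ (PreTwistedSum Φ) := (filterBasis Φ).continuousSMul

/-- The uniformity of the quasinorm: `x` and `y` are close when `‖y - x‖_Φ` is small. -/
instance : UniformSpace (PreTwistedSum Φ) := IsTopologicalAddGroup.rightUniformSpace _

instance : IsUniformAddGroup (PreTwistedSum Φ) := isUniformAddGroup_of_addCommGroup

instance : UniformContinuousConstSMul ℝ (PreTwistedSum Φ) :=
  uniformContinuousConstSMul_of_continuousConstSMul ℝ _

theorem nhds_zero_hasBasis :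
    (𝓝 (0 : PreTwistedSum Φ)).HasBasis (fun ε : ℝ => 0 < ε) (fun ε => {x | qnorm Φ x < ε}) := by
  refine (filterBasis Φ).toAddGroupFilterBasis.nhds_zero_hasBasis.to_hasBasis ?_ ?_
  · rintro _ ⟨ε, hε, rfl⟩
    exact ⟨ε, hε, subset_rfl⟩
  · intro ε hε
    exact ⟨_, ⟨ε, hε, rfl⟩, subset_rfl⟩

/-- The map `(α, u) ↦ u` from `ℝ ⊕ c₀₀` to `ℓ₁`, as a linear map. -/
def projₗ : PreTwistedSum Φ →ₗ[ℝ] L1 :=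
  c00ToL1 ∘ₗ LinearMap.snd ℝ ℝ (ℕ →₀ ℝ) ∘ₗ (toProd Φ).toLinearMap

theorem norm_projₗ_le (x : PreTwistedSum Φ) : ‖projₗ Φ x‖ ≤ qnorm Φ x := by
  change ‖c00ToL1 (toProd Φ x).2‖ ≤ _
  rw [norm_c00ToL1, qnorm]
  exact le_add_of_nonneg_left (abs_nonneg _)

/-- The map `(α, u) ↦ u` from `ℝ ⊕ c₀₀` to `ℓ₁`, continuous for the quasinorm. -/
def proj : PreTwistedSum Φ →L[ℝ] L1 where
  toLinearMap := projₗ Φ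
  cont := by
    refine continuous_of_continuousAt_zero (projₗ Φ) ?_
    rw [ContinuousAt, map_zero, (nhds_zero_hasBasis Φ).tendsto_iff Metric.nhds_basis_ball]
    exact fun ε hε => ⟨ε, hε, fun x hx =>
      mem_ball_zero_iff.2 ((norm_projₗ_le Φ x).trans_lt hx)⟩

end PreTwistedSum

/-- The twisted sum `ℝ ⊕_Φ ℓ₁`: the completion of `ℝ ⊕ c₀₀` under the quasinorm
`‖(α, u)‖_Φ = |α - Φ u| + ‖u‖₁`. -/
abbrev TwistedSum (Φ : QuasilinearMap) : Type := UniformSpace.Completion (PreTwistedSum Φ)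

namespace TwistedSum

variable (Φ : QuasilinearMap)

/-- The canonical map from `ℝ ⊕ c₀₀` to its completion. -/
def incl : PreTwistedSum Φ →L[ℝ] TwistedSum Φ where
  toFun x := (x : UniformSpace.Completion (PreTwistedSum Φ))
  map_add' x y := UniformSpace.Completion.coe_add x y
  map_smul' c x := UniformSpace.Completion.coe_smul c x
  cont := UniformSpace.Completion.continuous_coe _

/-- The vector `e₀ = (1, 0)`. -/
def e0 : TwistedSum Φ := incl Φ ((PreTwistedSum.toProd Φ).symm (1, 0))

/-- The quotient map `π : ℝ ⊕_Φ ℓ₁ → ℓ₁`: the continuous linear extension of `(α, u) ↦ u`. -/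
def quotientMap : TwistedSum Φ →L[ℝ] L1 :=
  (PreTwistedSum.proj Φ).extend (incl Φ)

theorem quotientMap_incl (x : PreTwistedSum Φ) :
    quotientMap Φ (incl Φ x) = PreTwistedSum.proj Φ x :=
  ContinuousLinearMap.extend_eq (PreTwistedSum.proj Φ) UniformSpace.Completion.denseRange_coe
    (UniformSpace.Completion.isUniformInducing_coe _) x

end TwistedSum

/-! ### Notions for topological vector spaces -/

section TVS

variable {E F : Type*} [AddCommGroup E] [Module ℝ E] [TopologicalSpace E] [AddCommGroup F]
  [Module ℝ F] [TopologicalSpace F]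

/-- The closed linear span of a sequence. -/
abbrev closedSpan [ContinuousAdd E] [ContinuousConstSMul ℝ E] (x : ℕ → E) : Submodule ℝ E :=
  (Submodule.span ℝ (Set.range x)).topologicalClosure

/-- A basic sequence: a sequence that is a Schauder basis of its closed linear span, that is,
there are continuous coordinate functionals on the closed linear span, biorthogonal to the
sequence, and every vector `y` of the closed linear span is the limit of the partial sums of
its expansion. -/
def IsBasicSequence [ContinuousAdd E] [ContinuousConstSMul ℝ E] (x : ℕ → E) : Prop :=
  ∃ coord : ℕ → (closedSpan x →L[ℝ] ℝ),
    (∀ i j : ℕ, ∀ h : x j ∈ closedSpan x, coord i ⟨x j, h⟩ = if i = j then 1 else 0) ∧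
    ∀ y : closedSpan x,
      Tendsto (fun n => ∑ i ∈ Finset.range n, coord i y • x i) atTop (𝓝 (y : E))

/-- A continuous linear operator is strictly singular if it is not an isomorphism onto its image
on any infinite-dimensional closed subspace. -/
def IsStrictlySingular (T : E →L[ℝ] F) : Prop :=
  ∀ E₀ : Submodule ℝ E, IsClosed (E₀ : Set E) → ¬ FiniteDimensional ℝ E₀ →
    ¬ IsEmbedding (fun y : E₀ => T y)

/-- A topological vector space `(E, t)` is topologically minimal if it carries no strictly weaker
Hausdorff vector topology: every Hausdorff vector topology `τ` on `E` all of whose open sets are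
open for `t` is equal to `t` (in `t ≤ τ`, the finer topology is the smaller one). -/
def IsTopologicallyMinimal (E : Type*) [AddCommGroup E] [Module ℝ E]
    [t : TopologicalSpace E] : Prop :=
  ∀ τ : TopologicalSpace E, @IsTopologicalAddGroup E τ _ → @ContinuousSMul ℝ E _ _ τ →
    @T2Space E τ → t ≤ τ → τ = t

end TVS

end

/-! ### Neighbourhoods of zero in a topological vector space -/

section TopologicalVectorSpace

variable {E : Type*} [AddCommGroup E] [Module ℝ E]

/-! The kernel of `π` is the line spanned by `e₀`, and a vector with small image under `π` is small
up to a multiple of `e₀` (`exists_sub_smul_e0_mem`). If a closed subspace misses `e₀`, that multiple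
must be small too, so `π` embeds the subspace. Everything therefore turns on condition (2), and the
proof passes between subspaces missing `e₀` and sequences whose images in `ℓ₁` have a lower
`ℓ₁`-estimate.

From a subspace embedded by `π`, a gliding hump (`exists_seq_lower_estimate`) and a perturbation
into `ℝ ⊕ c₀₀` give an infinite-dimensional subspace of `c₀₀` on which `Φ` is bounded. There `u ↦
(0, u)` is continuous, so a copy of the `ℓ₁`-basis in that subspace lifts to `Y`. The lift is a
basic sequence and yields operators violating (6) and (7). Conversely, a basic sequence produces a
closed subspace missing `e₀`: a vector lying in all tails has zero coordinates.

For (2) → (4) and (2) → (6), a failure produces an ultrafilter whose image in `ℓ₁` is bounded but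
not Cauchy; for (6), `cauchy_of_cauchy_quotientMap` transfers non-convergence from `Y` to `ℓ₁`.
Differences along the ultrafilter can be chosen with small initial coordinates, and the gliding hump
turns them into a sequence whose closed span misses `e₀` (`exists_e0_notMem_of_lower_estimate`). For
(7), condition (2) makes every continuous functional vanish at `e₀`, so `T e₀ = c e₀` and `T - c I`
factors through `π`; (6) applies to the factor. For (4) → (2), a subspace missing `e₀` gives a
strictly weaker topology, induced by `Y/Y₀` together with the coordinates of `π`.

`Y` need not be locally convex, so estimates are made with balanced neighbourhoods;
`exists_seq_sum_mem` controls sums of perturbations. -/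

theorem Balanced.smul_mem_of_abs_le_one {V : Set E} (hV : Balanced ℝ V) {c : ℝ} (hc : |c| ≤ 1)
    {x : E} (hx : x ∈ V) : c • x ∈ V :=
  hV c (by simpa using hc) (Set.smul_mem_smul_set hx)

theorem Balanced.sub_mem_of_add_mem {U V : Set E} (hV : Balanced ℝ V)
    (h : ∀ v ∈ V, ∀ w ∈ V, v + w ∈ U) {v w : E} (hv : v ∈ V) (hw : w ∈ V) : v - w ∈ U := by
  rw [sub_eq_add_neg]
  exact h v hv _ (hV.neg_mem_iff.2 hw)

variable [TopologicalSpace E]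

theorem exists_balanced_add_mem [ContinuousAdd E] [ContinuousSMul ℝ E] {U : Set E}
    (hU : U ∈ 𝓝 0) : ∃ V ∈ 𝓝 (0 : E), Balanced ℝ V ∧ ∀ v ∈ V, ∀ w ∈ V, v + w ∈ U := by
  obtain ⟨W, hWo, hW0, hW⟩ := exists_open_nhds_zero_half hU
  obtain ⟨V, ⟨hV, hb⟩, hVW⟩ := (nhds_basis_balanced ℝ E).mem_iff.1 (hWo.mem_nhds hW0)
  exact ⟨V, hV, hb, fun v hv w hw => hW v (hVW hv) w (hVW hw)⟩

theorem exists_pos_smul_mem [ContinuousSMul ℝ E] {U : Set E} (hU : U ∈ 𝓝 0) (x : E) :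
    ∃ δ : ℝ, 0 < δ ∧ ∀ c : ℝ, |c| ≤ δ → c • x ∈ U := by
  have h : Tendsto (fun c : ℝ => c • x) (𝓝 0) (𝓝 0) := by
    have : Continuous fun c : ℝ => c • x := by fun_prop
    simpa using this.tendsto 0
  obtain ⟨δ, hδ, hb⟩ := Metric.nhds_basis_closedBall.mem_iff.1 (h hU)
  exact ⟨δ, hδ, fun c hc => hb (by simpa using hc)⟩

/-- A decreasing sequence of neighbourhoods whose finite sums stay in a given neighbourhood. -/
theorem exists_seq_sum_mem [ContinuousAdd E] [ContinuousSMul ℝ E] {U : Set E} (hU : U ∈ 𝓝 0) :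
    ∃ V : ℕ → Set E, (∀ n, V n ∈ 𝓝 (0 : E)) ∧
      ∀ (y : ℕ → E), (∀ n, y n ∈ V n) → ∀ a : ℕ →₀ ℝ, (∀ n, |a n| ≤ 1) →
        Finsupp.linearCombination ℝ y a ∈ U := by
  choose! g hg using fun (W : Set E) (hW : W ∈ 𝓝 (0 : E)) => exists_balanced_add_mem hW
  let V : ℕ → Set E := fun n => g^[n + 1] U
  have hV : ∀ n, V n ∈ 𝓝 (0 : E) := by
    intro n
    induction n with
    | zero => exact (hg U hU).1
    | succ n ih =>
      have := (hg _ ih).1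
      simpa only [V, Function.iterate_succ_apply' g (n + 1)] using this
  have hsucc : ∀ n, V (n + 1) = g (V n) := fun n => Function.iterate_succ_apply' g (n + 1) U
  have hbal : ∀ n, Balanced ℝ (V n) := by
    intro n
    cases n with
    | zero => exact (hg U hU).2.1
    | succ n => rw [hsucc]; exact (hg _ (hV n)).2.1
  have hadd : ∀ n, ∀ v ∈ V (n + 1), ∀ w ∈ V (n + 1), v + w ∈ V n := fun n => by
    rw [hsucc]; exact (hg _ (hV n)).2.2
  refine ⟨fun n => V (n + 1), fun n => hV _, fun y hy a ha => ?_⟩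
  have key : ∀ m n, ∑ i ∈ Finset.range m, a (n + i) • y (n + i) ∈ V n := by
    intro m
    induction m with
    | zero => intro n; simpa using mem_of_mem_nhds (hV n)
    | succ m ih =>
      intro n
      rw [Finset.sum_range_succ', add_comm]
      refine hadd n _ ((hbal _).smul_mem_of_abs_le_one (ha _) (hy n)) _ ?_
      simpa only [add_assoc, add_comm 1] using ih (n + 1)
  have hVU : V 0 ⊆ U := fun v hv => by
    simpa using (hg U hU).2.2 v hv 0 (mem_of_mem_nhds (hV 0))
  obtain ⟨m, hm⟩ := a.support.exists_nat_subset_range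
  refine hVU ?_
  rw [Finsupp.linearCombination_apply, Finsupp.sum_of_support_subset a hm _ (by simp)]
  simpa using key m 0

end TopologicalVectorSpace

/-! ### Vectors of the dense subspace and their quasinorms -/

namespace PreTwistedSum

variable (Φ : QuasilinearMap)

/-- The element `(α, u)` of `ℝ ⊕ c₀₀`. -/
noncomputable def pair (α : ℝ) (u : ℕ →₀ ℝ) : PreTwistedSum Φ := (toProd Φ).symm (α, u)

theorem exists_eq_pair (x : PreTwistedSum Φ) : ∃ α u, x = pair Φ α u :=
  ⟨(toProd Φ x).1, (toProd Φ x).2, ((toProd Φ).symm_apply_apply x).symm⟩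

theorem qnorm_pair (α : ℝ) (u : ℕ →₀ ℝ) : qnorm Φ (pair Φ α u) = |α - Φ u| + l1Norm u := by
  simp [qnorm, pair]

theorem qnorm_pair_self (u : ℕ →₀ ℝ) : qnorm Φ (pair Φ (Φ u) u) = l1Norm u := by
  simp [qnorm_pair]

theorem pair_sub_smul (α c : ℝ) (u : ℕ →₀ ℝ) :
    pair Φ α u - c • pair Φ 1 0 = pair Φ (α - c) u := by
  simp only [pair, ← map_smul, ← map_sub]
  simp

/-- The linear map `u ↦ (0, u)`. -/
noncomputable def zeroPair : (ℕ →₀ ℝ) →ₗ[ℝ] PreTwistedSum Φ :=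
  (toProd Φ).symm.toLinearMap ∘ₗ LinearMap.inr ℝ ℝ (ℕ →₀ ℝ)

theorem zeroPair_apply (u : ℕ →₀ ℝ) : zeroPair Φ u = pair Φ 0 u := rfl

end PreTwistedSum

/-! ### The topology of `Y` and the kernel of `π` -/

namespace TwistedSum

open PreTwistedSum

variable (Φ : QuasilinearMap)

theorem denseRange_incl : DenseRange (incl Φ) := UniformSpace.Completion.denseRange_coe

theorem isInducing_incl : IsInducing (incl Φ) :=
  (UniformSpace.Completion.isUniformInducing_coe _).isInducing

theorem exists_qnorm_lt_mem {U : Set (TwistedSum Φ)} (hU : U ∈ 𝓝 0) :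
    ∃ ε : ℝ, 0 < ε ∧ ∀ x, qnorm Φ x < ε → incl Φ x ∈ U := by
  have h := (incl Φ).continuous.tendsto 0
  rw [map_zero] at h
  obtain ⟨ε, hε, h⟩ := (nhds_zero_hasBasis Φ).mem_iff.1 (h hU)
  exact ⟨ε, hε, fun x hx => h hx⟩

theorem exists_mem_nhds_qnorm_lt {ε : ℝ} (hε : 0 < ε) :
    ∃ U ∈ 𝓝 (0 : TwistedSum Φ), ∀ x, incl Φ x ∈ U → qnorm Φ x < ε := by
  have h := (nhds_zero_hasBasis Φ).mem_of_mem hε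
  rw [(isInducing_incl Φ).nhds_eq_comap, map_zero] at h
  obtain ⟨U, hU, hUε⟩ := h
  exact ⟨U, hU, fun x hx => hUε hx⟩

/-- Completion gives continuity in the vector for each fixed scalar. Joint continuity needs
uniformity over `|c| ≤ 1`, which the quasinorm balls have and which passes to their closures. -/
instance : ContinuousSMul ℝ (TwistedSum Φ) := by
  have key : ∀ U ∈ 𝓝 (0 : TwistedSum Φ), ∃ V ∈ 𝓝 (0 : TwistedSum Φ),
      ∀ c : ℝ, |c| ≤ 1 → ∀ x ∈ V, c • x ∈ U := by
    intro U hU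
    obtain ⟨W, ⟨hW, hWc⟩, hWU⟩ := (closed_nhds_basis (0 : TwistedSum Φ)).mem_iff.1 hU
    obtain ⟨ε, hε, h⟩ := exists_qnorm_lt_mem Φ hW
    refine ⟨closure (incl Φ '' {x | qnorm Φ x < ε}), ?_, fun c hc x hx => hWU ?_⟩
    · have := (UniformSpace.Completion.isDenseInducing_coe
        (α := PreTwistedSum Φ)).closure_image_mem_nhds
        ((nhds_zero_hasBasis Φ).mem_of_mem hε)
      exact this
    · refine hWc.closure_subset
        (map_mem_closure (continuous_const_smul c) hx ?_)
      rintro _ ⟨y, hy, rfl⟩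
      have hy' : qnorm Φ y < ε := hy
      change c • incl Φ y ∈ W
      rw [← map_smul]
      refine h _ ?_
      rw [qnorm_smul]
      have := qnorm_nonneg Φ y
      nlinarith
  refine ContinuousSMul.of_nhds_zero ?_ ?_ ?_
  · intro U hU
    obtain ⟨V, hV, h⟩ := key U hU
    refine mem_map.2 (mem_of_superset
      (prod_mem_prod (Metric.closedBall_mem_nhds (0 : ℝ) one_pos) hV) ?_)
    rintro ⟨c, x⟩ ⟨hc, hx⟩
    exact h c (by simpa using hc) x hx
  · intro y U hU
    obtain ⟨W, hWo, hW0, hW⟩ := exists_open_nhds_zero_half hU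
    obtain ⟨V, hV, h⟩ := key W (hWo.mem_nhds hW0)
    have hV' : {z | y - z ∈ V} ∈ 𝓝 y := by
      have : Tendsto (fun z => y - z) (𝓝 y) (𝓝 0) := by
        have h1 : Continuous fun z => y - z := by fun_prop
        simpa using h1.tendsto y
      exact this hV
    -- Replace `y` by a nearby `z` of the dense subspace, where scalar multiplication is already
    -- jointly continuous; the error is controlled uniformly in `|c| ≤ 1`.
    obtain ⟨_, hz, z, rfl⟩ := mem_closure_iff_nhds.1 (denseRange_incl Φ y) _ hV'
    have h1 : Tendsto (fun c : ℝ => incl Φ (c • z)) (𝓝 0) (𝓝 0) := by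
      have : Continuous fun c : ℝ => incl Φ (c • z) := by fun_prop
      simpa using this.tendsto 0
    rw [mem_map]
    filter_upwards [h1 (hWo.mem_nhds hW0), Metric.closedBall_mem_nhds (0 : ℝ) one_pos]
      with c hc hc1
    have hcy : c • y = c • (y - incl Φ z) + incl Φ (c • z) := by
      rw [map_smul, smul_sub, sub_add_cancel]
    change c • y ∈ U
    rw [hcy]
    exact hW _ (h c (by simpa using hc1) _ hz) _ hc
  · intro c
    simpa using (continuous_const_smul (T := TwistedSum Φ) c).tendsto 0

theorem quotientMap_incl_pair (α : ℝ) (u : ℕ →₀ ℝ) :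
    quotientMap Φ (incl Φ (pair Φ α u)) = c00ToL1 u := quotientMap_incl Φ _

theorem quotientMap_e0 : quotientMap Φ (e0 Φ) = 0 :=
  (quotientMap_incl_pair Φ 1 0).trans (map_zero _)

theorem e0_ne_zero : e0 Φ ≠ 0 := by
  intro h
  obtain ⟨U, hU, hq⟩ := exists_mem_nhds_qnorm_lt Φ one_pos
  have h1 := hq (pair Φ 1 0) (by
    change e0 Φ ∈ U
    rw [h]
    exact mem_of_mem_nhds hU)
  have h0 : Φ 0 = 0 := by simpa using Φ.map_smul' 0 0
  rw [qnorm_pair, h0] at h1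
  have := l1Norm_nonneg 0
  norm_num at h1
  linarith

/-- Up to multiples of `e₀`, small image under the quotient map means small. -/
theorem exists_sub_smul_e0_mem {U : Set (TwistedSum Φ)} (hU : U ∈ 𝓝 0) :
    ∃ η : ℝ, 0 < η ∧ ∀ y, ‖quotientMap Φ y‖ < η → ∃ c : ℝ, y - c • e0 Φ ∈ U := by
  obtain ⟨W, hWo, hW0, hW⟩ := exists_open_nhds_zero_half hU
  obtain ⟨ε, hε, h⟩ := exists_qnorm_lt_mem Φ (hWo.mem_nhds hW0)
  refine ⟨ε, hε, fun y hy => ?_⟩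
  have h1 : {z | y - z ∈ W} ∈ 𝓝 y := by
    have h1 : Continuous fun z => y - z := by fun_prop
    exact (by simpa using h1.tendsto y : Tendsto (fun z => y - z) (𝓝 y) (𝓝 0))
      (hWo.mem_nhds hW0)
  have h2 : {z | ‖quotientMap Φ z‖ < ε} ∈ 𝓝 y :=
    (isOpen_lt (by fun_prop) continuous_const).mem_nhds hy
  obtain ⟨_, ⟨hz1, hz2⟩, z, rfl⟩ :=
    mem_closure_iff_nhds.1 (denseRange_incl Φ y) _ (inter_mem h1 h2)
  obtain ⟨α, u, rfl⟩ := exists_eq_pair Φ z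
  rw [Set.mem_ofPred_eq, quotientMap_incl_pair, norm_c00ToL1] at hz2
  -- This multiple of `e₀` moves `(α, u)` to `(Φ u, u)`, whose quasinorm is just `‖u‖₁`.
  refine ⟨α - Φ u, ?_⟩
  have h3 := hW _ hz1 _ (h (pair Φ (Φ u) u) (by rwa [qnorm_pair_self]))
  have h4 : pair Φ (Φ u) u = pair Φ α u - (α - Φ u) • pair Φ 1 0 := by
    rw [pair_sub_smul, sub_sub_cancel]
  rw [h4, map_sub, map_smul] at h3
  rw [show y - (α - Φ u) • e0 Φ = y - incl Φ (pair Φ α u) +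
    (incl Φ (pair Φ α u) - (α - Φ u) • incl Φ (pair Φ 1 0)) by simp only [e0, pair]; abel]
  exact h3

/-- When `π y = 0`, `exists_sub_smul_e0_mem` applies to every neighbourhood, so `y` lies in the
closure of the line through `e₀`, which is closed because it is finite-dimensional. -/
theorem exists_eq_smul_e0 {y : TwistedSum Φ} (hy : quotientMap Φ y = 0) :
    ∃ c : ℝ, y = c • e0 Φ := by
  have hcl := (Submodule.span ℝ {e0 Φ}).closed_of_finiteDimensional
  have : y ∈ closure (Submodule.span ℝ {e0 Φ} : Set (TwistedSum Φ)) := by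
    rw [mem_closure_iff_nhds_zero]
    intro U hU
    have hU' : -U ∈ 𝓝 (0 : TwistedSum Φ) := by simpa using neg_mem_nhds_zero _ hU
    obtain ⟨η, hη, h⟩ := exists_sub_smul_e0_mem Φ hU'
    obtain ⟨c, hc⟩ := h y (by simpa [hy] using hη)
    exact ⟨c • e0 Φ, Submodule.smul_mem _ _ (Submodule.mem_span_singleton_self _),
      by simpa using hc⟩
  rw [hcl.closure_eq] at this
  obtain ⟨c, rfl⟩ := Submodule.mem_span_singleton.1 this
  exact ⟨c, rfl⟩

/-- A subspace on which smallness of the quotient map forces membership in a set whose closure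
misses `e₀` has a closure missing `e₀`. -/
theorem e0_notMem_closure {G : Submodule ℝ (TwistedSum Φ)} {U : Set (TwistedSum Φ)} {η : ℝ}
    (hη : 0 < η) (hU : e0 Φ ∉ closure U) (h : ∀ g ∈ G, ‖quotientMap Φ g‖ < η → g ∈ U) :
    e0 Φ ∉ G.topologicalClosure := by
  intro he
  refine hU (mem_closure_iff_nhds.2 fun W hW => ?_)
  have h2 : {z | ‖quotientMap Φ z‖ < η} ∈ 𝓝 (e0 Φ) :=
    (isOpen_lt (by fun_prop) continuous_const).mem_nhds (by simpa [quotientMap_e0] using hη)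
  obtain ⟨z, ⟨hz1, hz2⟩, hz⟩ := mem_closure_iff_nhds.1 he _ (inter_mem hW h2)
  exact ⟨z, hz1, h z hz hz2⟩

end TwistedSum

/-! ### The space `ℓ₁` -/

theorem hasSum_abs_L1 (w : L1) : HasSum (fun i => |w i|) ‖w‖ := by
  simpa using lp.hasSum_norm (p := 1) (by simp) w

theorem sum_abs_le_norm_L1 (w : L1) (s : Finset ℕ) : ∑ i ∈ s, |w i| ≤ ‖w‖ :=
  sum_le_hasSum s (fun _ _ => abs_nonneg _) (hasSum_abs_L1 w)

theorem abs_apply_le_norm_L1 (w : L1) (i : ℕ) : |w i| ≤ ‖w‖ := by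
  simpa using sum_abs_le_norm_L1 w {i}

theorem c00ToL1_single (n : ℕ) (c : ℝ) :
    c00ToL1 (Finsupp.single n c) = lp.single 1 n c := by
  ext i
  rw [c00ToL1_apply, lp.coeFn_single, Finsupp.single_eq_pi_single]

theorem c00ToL1_injective : Function.Injective c00ToL1 := fun u v h => by
  ext i
  rw [← c00ToL1_apply u, h, c00ToL1_apply]

theorem hasSum_c00ToL1_single (w : L1) :
    HasSum (fun i => c00ToL1 (Finsupp.single i (w i))) w := by
  simp only [c00ToL1_single]
  exact lp.hasSum_single (by simp) w

theorem denseRange_c00ToL1 : DenseRange c00ToL1 := fun w =>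
  mem_closure_of_tendsto (hasSum_c00ToL1_single w)
    (Eventually.of_forall fun s => ⟨∑ i ∈ s, Finsupp.single i (w i), map_sum _ _ _⟩)

theorem l1Norm_single (n : ℕ) (c : ℝ) : l1Norm (Finsupp.single n c) = |c| := by
  rw [← norm_c00ToL1, c00ToL1_single, lp.norm_single (by simp), Real.norm_eq_abs]

theorem abs_apply_le_l1Norm (u : ℕ →₀ ℝ) (i : ℕ) : |u i| ≤ l1Norm u := by
  rw [← norm_c00ToL1]
  exact abs_apply_le_norm_L1 (c00ToL1 u) i

theorem norm_linearCombination_le {E : Type*} [NormedAddCommGroup E] [NormedSpace ℝ E] {C : ℝ}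
    {d : ℕ → E} (hd : ∀ n, ‖d n‖ ≤ C) (a : ℕ →₀ ℝ) :
    ‖Finsupp.linearCombination ℝ d a‖ ≤ C * l1Norm a := by
  rw [Finsupp.linearCombination_apply, Finsupp.sum, l1Norm, Finset.mul_sum]
  refine norm_sum_le_of_le _ fun i _ => ?_
  rw [norm_smul, Real.norm_eq_abs, mul_comm]
  exact mul_le_mul_of_nonneg_right (hd i) (abs_nonneg _)

/-- A linear map on `c₀₀` that is continuous for the `ℓ₁`-norm extends to `ℓ₁`. -/
theorem exists_extend_c00 {Z : Type*} [AddCommGroup Z] [Module ℝ Z] [UniformSpace Z]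
    [IsUniformAddGroup Z] [ContinuousConstSMul ℝ Z] [T0Space Z] [CompleteSpace Z]
    (A : (ℕ →₀ ℝ) →ₗ[ℝ] Z)
    (hA : ∀ U ∈ 𝓝 (0 : Z), ∃ η : ℝ, 0 < η ∧ ∀ u, l1Norm u < η → A u ∈ U) :
    ∃ T : L1 →L[ℝ] Z, ∀ u, T (c00ToL1 u) = A u := by
  let e := LinearEquiv.ofInjective c00ToL1 c00ToL1_injective
  let f₀ : LinearMap.range c00ToL1 →ₗ[ℝ] Z := A ∘ₗ e.symm.toLinearMap
  have hf : Continuous f₀ := by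
    refine continuous_of_continuousAt_zero f₀ ?_
    rw [ContinuousAt, map_zero]
    intro U hU
    obtain ⟨η, hη, h⟩ := hA U hU
    rw [mem_map]
    filter_upwards [Metric.ball_mem_nhds 0 hη] with x hx
    refine h _ ?_
    rw [← norm_c00ToL1, ← LinearEquiv.ofInjective_apply (h := c00ToL1_injective)]
    change ‖((e (e.symm x) : LinearMap.range c00ToL1) : L1)‖ < η
    rw [e.apply_symm_apply]
    simpa using hx
  let f : LinearMap.range c00ToL1 →L[ℝ] Z := ⟨f₀, hf⟩
  have hd : DenseRange (LinearMap.range c00ToL1).subtypeL := by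
    rw [DenseRange, show Set.range (LinearMap.range c00ToL1).subtypeL = Set.range c00ToL1 from
      Subtype.range_coe]
    exact denseRange_c00ToL1
  refine ⟨f.extend (LinearMap.range c00ToL1).subtypeL, fun u => ?_⟩
  have h := f.extend_eq hd isUniformEmbedding_subtype_val.isUniformInducing (e u)
  have h2 : f (e u) = A u := by
    change A (e.symm (e u)) = A u
    rw [e.symm_apply_apply]
  rw [← h2, ← h]
  rfl

/-- Gliding hump: small initial coordinates allow the choice of a sequence with a lower
`ℓ₁`-estimate. -/
theorem exists_seq_lower_estimate {P : ℕ → L1 → Prop} {ε : ℝ} (hε : 0 < ε)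
    (h : ∀ n N (η : ℝ), 0 < η → ∃ d, P n d ∧ ε ≤ ‖d‖ ∧ ∀ i < N, |d i| ≤ η) :
    ∃ d : ℕ → L1, (∀ n, P n (d n)) ∧
      ∀ a : ℕ →₀ ℝ, ε / 2 * l1Norm a ≤ ‖Finsupp.linearCombination ℝ d a‖ := by
  have step : ∀ n N, ∃ d M, P n d ∧ N ≤ M ∧ ε ≤ ‖d‖ ∧
      ‖d‖ - ε / 4 ≤ ∑ i ∈ Finset.Ico N M, |d i| := by
    intro n N
    -- The first `N` coordinates contribute at most `ε / 8` and the tail beyond `M` another `ε / 8`,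
    -- so the block between them carries all but `ε / 4` of the norm.
    obtain ⟨d, hP, hd, hi⟩ := h n N (ε / (8 * (N + 1))) (by positivity)
    have h1 : ∑ i ∈ Finset.range N, |d i| ≤ ε / 8 := by
      calc ∑ i ∈ Finset.range N, |d i| ≤ ∑ i ∈ Finset.range N, ε / (8 * (N + 1)) :=
            Finset.sum_le_sum fun i hiN => hi i (Finset.mem_range.1 hiN)
        _ = N * (ε / (8 * (N + 1))) := by simp
        _ ≤ ε / 8 := by
          rw [mul_div_assoc', div_le_div_iff₀ (by positivity) (by norm_num)]
          nlinarith
    obtain ⟨M, hM, hNM⟩ := (((hasSum_abs_L1 d).tendsto_sum_nat.eventually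
      (lt_mem_nhds (show ‖d‖ - ε / 8 < ‖d‖ by linarith))).and (eventually_ge_atTop N)).exists
    refine ⟨d, M, hP, hNM, hd, ?_⟩
    have := Finset.sum_range_add_sum_Ico (fun i => |d i|) hNM
    linarith
  choose D M hP hM hn hs using step
  let N : ℕ → ℕ := fun n => Nat.rec 0 (fun n k => M n k) n
  have hN : ∀ n, N (n + 1) = M n (N n) := fun n => rfl
  have hmono : Monotone N := monotone_nat_of_le_succ fun n => hM n _
  let I : ℕ → Finset ℕ := fun n => Finset.Ico (N n) (N (n + 1))
  have hdisj : Pairwise (Function.onFun Disjoint I) := by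
    intro i j hij
    refine Finset.disjoint_left.2 fun k hk hk' => ?_
    rw [Finset.mem_Ico] at hk hk'
    rcases hij.lt_or_gt with hlt | hlt
    · have := hmono (Nat.succ_le_of_lt hlt)
      exact absurd (hk.2.trans_le (this.trans hk'.1)) (lt_irrefl _)
    · have := hmono (Nat.succ_le_of_lt hlt)
      exact absurd (hk'.2.trans_le (this.trans hk.1)) (lt_irrefl _)
  let d : ℕ → L1 := fun n => D n (N n)
  have hsum : ∀ (w : L1) (A : Finset ℕ), ∑ n ∈ A, ∑ i ∈ I n, |w i| ≤ ‖w‖ := by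
    intro w A
    rw [← Finset.sum_biUnion fun i _ j _ hij => hdisj hij]
    exact sum_abs_le_norm_L1 w _
  refine ⟨d, fun n => hP n _, fun a => ?_⟩
  set A := a.support
  set w := Finsupp.linearCombination ℝ d a with hw
  have hwi : ∀ i, w i = ∑ m ∈ A, a m * d m i := by
    intro i
    rw [hw, Finsupp.linearCombination_apply, Finsupp.sum, lp.coeFn_sum, Finset.sum_apply]
    rfl
  -- The diagonal term is doubled so that the subtracted sum may run over all `m`, including `n`.
  -- After summation and exchange of the sums, the coefficient of `|a n|` is at least `2 (‖d n‖ - ε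
  -- / 4) - ‖d n‖ ≥ ε / 2`.
  have h1 : ∀ n ∈ A, 2 * (|a n| * ∑ i ∈ I n, |d n i|) -
      ∑ m ∈ A, |a m| * ∑ i ∈ I n, |d m i| ≤ ∑ i ∈ I n, |w i| := by
    intro n hnA
    rw [Finset.mul_sum, Finset.mul_sum]
    simp only [Finset.mul_sum]
    rw [Finset.sum_comm, ← Finset.sum_sub_distrib]
    refine Finset.sum_le_sum fun i _ => ?_
    rw [hwi, ← Finset.add_sum_erase A _ hnA, ← Finset.add_sum_erase A _ hnA]
    have h2 : |∑ m ∈ A.erase n, a m * d m i| ≤ ∑ m ∈ A.erase n, |a m| * |d m i| := by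
      simpa only [abs_mul] using Finset.abs_sum_le_sum_abs (fun m => a m * d m i) (A.erase n)
    have h3 := abs_sub_abs_le_abs_sub (a n * d n i) (-∑ m ∈ A.erase n, a m * d m i)
    rw [abs_neg, sub_neg_eq_add, abs_mul] at h3
    linarith
  have h2 := (Finset.sum_le_sum h1).trans (hsum w A)
  rw [Finset.sum_sub_distrib, Finset.sum_comm] at h2
  have h3 : ∀ m ∈ A, ∑ n ∈ A, |a m| * ∑ i ∈ I n, |d m i| ≤ |a m| * ‖d m‖ := by
    intro m _
    rw [← Finset.mul_sum]
    exact mul_le_mul_of_nonneg_left (hsum _ _) (abs_nonneg _)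
  have h4 := Finset.sum_le_sum h3
  rw [l1Norm, Finset.mul_sum]
  refine le_trans ?_ h2
  refine le_trans ?_ (sub_le_sub_left h4 _)
  rw [← Finset.sum_sub_distrib]
  refine Finset.sum_le_sum fun n _ => ?_
  have h5 : ‖d n‖ - ε / 4 ≤ ∑ i ∈ I n, |d n i| := hs n (N n)
  have h6 : ε ≤ ‖d n‖ := hn n (N n)
  have h7 := abs_nonneg (a n)
  nlinarith

/-- The first `n` coordinates map into a finite-dimensional space, so they have a common nonzero
kernel vector, which is then normalized. -/
theorem exists_norm_eq_one_of_infinite {V : Type*} [AddCommGroup V] [Module ℝ V]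
    (hV : ¬ FiniteDimensional ℝ V) (p : V →ₗ[ℝ] L1) (hp : Function.Injective p) (n : ℕ) :
    ∃ v, ‖p v‖ = 1 ∧ ∀ i < n, p v i = 0 := by
  let q : V →ₗ[ℝ] (Fin n → ℝ) :=
    LinearMap.pi fun i => (lp.evalCLM ℝ (fun _ : ℕ => ℝ) 1 (i : ℕ)).toLinearMap ∘ₗ p
  have hq : ¬ Function.Injective q := fun h => hV (FiniteDimensional.of_injective q h)
  rw [← LinearMap.ker_eq_bot, Submodule.eq_bot_iff] at hq
  push Not at hq
  obtain ⟨v, hv, hv0⟩ := hq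
  have hpv : ‖p v‖ ≠ 0 := by
    rw [norm_ne_zero_iff]
    exact fun h => hv0 (hp (h.trans (map_zero p).symm))
  refine ⟨‖p v‖⁻¹ • v, ?_, fun i hi => ?_⟩
  · rw [map_smul, norm_smul, norm_inv, norm_norm, inv_mul_cancel₀ hpv]
  · have h : q v ⟨i, hi⟩ = 0 := by rw [LinearMap.mem_ker.1 hv]; rfl
    have h' : p v i = 0 := h
    rw [map_smul, lp.coeFn_smul, Pi.smul_apply, h', smul_zero]

/-- A bounded ultrafilter on `ℓ₁` that is not Cauchy has large differences with small initial
coordinates. -/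
theorem exists_sub_small_of_not_cauchy {X : Type*} (𝒰 : Ultrafilter X) (f : X → L1) {C : ℝ}
    (hC : ∀ᶠ x in 𝒰, ‖f x‖ ≤ C) (hf : ¬ Cauchy (map f 𝒰)) :
    ∃ ε : ℝ, 0 < ε ∧ ∀ A ∈ 𝒰, ∀ N (η : ℝ), 0 < η →
      ∃ x ∈ A, ∃ y ∈ A, ε ≤ ‖f x - f y‖ ∧ ∀ i < N, |(f x - f y) i| ≤ η := by
  rw [Metric.cauchy_iff] at hf
  push Not at hf
  obtain ⟨ε, hε, h⟩ := hf inferInstance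
  refine ⟨ε, hε, fun A hA N η hη => ?_⟩
  -- Bounded coordinates converge along an ultrafilter. Near these limits any two points have close
  -- initial coordinates, while failure of the Cauchy property keeps some pair `ε` apart.
  have hlim : ∀ i, ∃ l : ℝ, Tendsto (fun x => f x i) 𝒰 (𝓝 l) := by
    intro i
    obtain ⟨l, -, hl⟩ := (isCompact_closedBall (0 : ℝ) C).ultrafilter_le_nhds
      (𝒰.map fun x => f x i) (by
        rw [le_principal_iff, Ultrafilter.coe_map, mem_map]
        filter_upwards [hC] with x hx
        simpa using (abs_apply_le_norm_L1 (f x) i).trans hx)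
    exact ⟨l, hl⟩
  choose l hl using hlim
  have hev : ∀ᶠ x in 𝒰, ∀ i ∈ Finset.range N, |f x i - l i| < η / 2 := by
    rw [eventually_all_finset]
    intro i _
    have := (hl i).eventually (Metric.ball_mem_nhds (l i) (half_pos hη))
    simpa [Real.dist_eq] using this
  obtain ⟨_, ⟨x, ⟨hxA, hx⟩, rfl⟩, _, ⟨y, ⟨hyA, hy⟩, rfl⟩, hxy⟩ :=
    h (f '' (A ∩ {x | ∀ i ∈ Finset.range N, |f x i - l i| < η / 2}))
      (image_mem_map (inter_mem hA hev))
  refine ⟨x, hxA, y, hyA, by rwa [← dist_eq_norm], fun i hi => ?_⟩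
  have h1 := hx i (Finset.mem_range.2 hi)
  have h2 := hy i (Finset.mem_range.2 hi)
  rw [lp.coeFn_sub, Pi.sub_apply]
  rw [abs_lt] at h1 h2
  rw [abs_le]
  constructor <;> linarith

theorem not_separated_of_mem_isCompact {E : Type*} [PseudoMetricSpace E] {K : Set E}
    (hK : IsCompact K) {x : ℕ → E} (hx : ∀ n, x n ∈ K) {ε : ℝ} (hε : 0 < ε) :
    ¬ ∀ m n, m ≠ n → ε ≤ dist (x m) (x n) := by
  intro h
  obtain ⟨_, -, φ, hφ, hlim⟩ := hK.tendsto_subseq hx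
  obtain ⟨N, hN⟩ := Metric.cauchySeq_iff.1 hlim.cauchySeq ε hε
  exact (h _ _ (hφ (Nat.lt_succ_self N)).ne').not_gt (hN (N + 1) N.le_succ N le_rfl)

/-! ### Bounded sets of `Y` and their images in `ℓ₁` -/

namespace TwistedSum

open PreTwistedSum

variable (Φ : QuasilinearMap)

open scoped Pointwise in
/-- A bounded ultrafilter whose image in `ℓ₁` is Cauchy is Cauchy. -/
theorem cauchy_of_cauchy_quotientMap {X : Type*} (𝒰 : Ultrafilter X) (g : X → TwistedSum Φ)
    {S : Set (TwistedSum Φ)} (hS : Bornology.IsVonNBounded ℝ S) (hgS : ∀ᶠ x in 𝒰, g x ∈ S)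
    (hg : Cauchy (map (fun x => quotientMap Φ (g x)) 𝒰)) : Cauchy (map g 𝒰) := by
  rw [cauchy_iff]
  refine ⟨inferInstance, fun s hs => ?_⟩
  rw [uniformity_eq_comap_nhds_zero] at hs
  obtain ⟨U, hU, hUs⟩ := hs
  obtain ⟨V, hV, -, hVU⟩ := exists_balanced_add_mem hU
  obtain ⟨V₁, hV₁, hV₁b, hV₁V⟩ := exists_balanced_add_mem hV
  obtain ⟨W, ⟨hW, hWb⟩, heW⟩ := (nhds_basis_balanced ℝ (TwistedSum Φ)).mem_iff.1
    (isOpen_compl_singleton.mem_nhds (show (0 : TwistedSum Φ) ∈ {e0 Φ}ᶜ from (e0_ne_zero Φ).symm))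
  have heW : e0 Φ ∉ W := fun h => heW h rfl
  obtain ⟨W₁, hW₁, hW₁b, hW₁W⟩ := exists_balanced_add_mem hW
  obtain ⟨W₂, hW₂, hW₂b, hW₂W⟩ := exists_balanced_add_mem hW₁
  obtain ⟨r, hr, hrS⟩ := (hS hW₂).exists_pos
  set R := max r 1
  have hR : 1 ≤ R := le_max_right _ _
  have hR0 : 0 < R := by linarith
  have hSR : S ⊆ R • W₂ := hrS R (by
    rw [Real.norm_eq_abs, abs_of_pos hR0]; exact le_max_left _ _)
  obtain ⟨η, hη, h⟩ := exists_sub_smul_e0_mem Φ (inter_mem hV₁ hW₂)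
  obtain ⟨t, ht, htη⟩ := (Metric.cauchy_iff.1 hg).2 η hη
  have hA : ∀ᶠ x in 𝒰, g x ∈ S ∧ quotientMap Φ (g x) ∈ t := hgS.and ht
  obtain ⟨x₀, hx₀S, hx₀⟩ := hA.exists
  have hc : ∀ x, ∃ c : ℝ, quotientMap Φ (g x) ∈ t → g x - g x₀ - c • e0 Φ ∈ V₁ ∩ W₂ := by
    intro x
    by_cases hx : quotientMap Φ (g x) ∈ t
    · obtain ⟨c, hc⟩ := h (g x - g x₀) (by
        rw [map_sub, ← dist_eq_norm]; exact htη _ hx _ hx₀)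
      exact ⟨c, fun _ => hc⟩
    · exact ⟨0, fun h => (hx h).elim⟩
  choose c hc using hc
  -- Since `S ⊆ R • W₂`, the vector `(c x / R) • e₀` lies in `W`. If `|c x| > R`, balancedness would
  -- put `e₀` itself in `W`.
  have hbound : ∀ᶠ x in 𝒰, c x ∈ Metric.closedBall (0 : ℝ) R := by
    filter_upwards [hA] with x ⟨hxS, hx⟩
    rw [mem_closedBall_zero_iff, Real.norm_eq_abs]
    by_contra! hlt
    obtain ⟨s, hs, hsx⟩ := hSR hxS
    obtain ⟨s₀, hs₀, hsx₀⟩ := hSR hx₀S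
    have h0 : c x ≠ 0 := by
      intro h0
      rw [h0, abs_zero] at hlt
      linarith
    have hv := (hc x hx).2
    set v := g x - g x₀ - c x • e0 Φ with hv'
    have hz : (s - s₀) + (-R⁻¹) • v ∈ W := by
      refine hW₁W _ (hW₂b.sub_mem_of_add_mem hW₂W hs hs₀) _ ?_
      have := hW₂W _ (hW₂b.smul_mem_of_abs_le_one (c := -R⁻¹) (by
        rw [abs_neg, abs_inv, abs_of_pos hR0]; exact inv_le_one_of_one_le₀ hR) hv) 0
        (mem_of_mem_nhds hW₂)
      rwa [add_zero] at this
    refine heW ?_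
    have he : e0 Φ = (R / c x) • ((s - s₀) + (-R⁻¹) • v) := by
      have hsx' : g x = R • s := hsx.symm
      have hsx₀' : g x₀ = R • s₀ := hsx₀.symm
      have hR1 : R ≠ 0 := hR0.ne'
      rw [hv', hsx', hsx₀']
      have : (s - s₀) + (-R⁻¹) • (R • s - R • s₀ - c x • e0 Φ) = (c x / R) • e0 Φ := by
        rw [smul_sub, smul_sub, smul_smul, smul_smul, smul_smul]
        have : -R⁻¹ * R = -1 := by field_simp
        rw [this, show -R⁻¹ * c x = -(c x / R) by field_simp]
        module
      rw [this, smul_smul, div_mul_div_comm, mul_comm, div_self (mul_ne_zero h0 hR1), one_smul]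
    rw [he]
    refine hWb.smul_mem_of_abs_le_one ?_ hz
    rw [abs_div, abs_of_pos hR0]
    exact (div_le_one (by linarith)).2 hlt.le
  -- The bounded coefficients converge along the ultrafilter, so the `e₀`-components are Cauchy as
  -- well.
  obtain ⟨l, -, hl⟩ := (isCompact_closedBall (0 : ℝ) R).ultrafilter_le_nhds (𝒰.map c)
    (le_principal_iff.2 hbound)
  obtain ⟨δ, hδ, hδV⟩ := exists_pos_smul_mem hV (e0 Φ)
  have hl' : ∀ᶠ x in 𝒰, c x ∈ Metric.ball l (δ / 2) := hl (Metric.ball_mem_nhds l (half_pos hδ))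
  refine ⟨g '' {x | quotientMap Φ (g x) ∈ t ∧ c x ∈ Metric.ball l (δ / 2)},
    image_mem_map ((hA.mono fun _ h => h.2).and hl'), ?_⟩
  rintro ⟨_, _⟩ ⟨⟨x, ⟨hx, hxl⟩, rfl⟩, y, ⟨hy, hyl⟩, rfl⟩
  refine hUs ?_
  change g y - g x ∈ U
  have h1 := hV₁b.sub_mem_of_add_mem hV₁V (hc y hy).1 (hc x hx).1
  have h2 : (c y - c x) • e0 Φ ∈ V := hδV _ (by
    have h3 := dist_triangle_right (c y) (c x) l
    rw [Metric.mem_ball] at hxl hyl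
    rw [Real.dist_eq] at h3
    linarith)
  convert hVU _ h1 _ h2 using 1
  module

end TwistedSum

/-! ### Consequences of boundedness of `Φ` on a large subspace -/

theorem not_finiteDimensional_c00 : ¬ FiniteDimensional ℝ (ℕ →₀ ℝ) := fun _ =>
  not_finite_iff_infinite.2 inferInstance
    (Module.Finite.finite_basis (Finsupp.basisSingleOne (R := ℝ) (ι := ℕ)))

/-- On an infinite-dimensional subspace of `c₀₀` there is a normalized sequence equivalent to
the unit vector basis of `ℓ₁`. -/
theorem exists_seq_mem_lower_estimate {F : Submodule ℝ (ℕ →₀ ℝ)}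
    (hF : ¬ FiniteDimensional ℝ F) :
    ∃ w : ℕ → ℕ →₀ ℝ, (∀ n, w n ∈ F) ∧ (∀ n, l1Norm (w n) = 1) ∧
      ∀ a : ℕ →₀ ℝ, 1 / 2 * l1Norm a ≤ l1Norm (Finsupp.linearCombination ℝ w a) := by
  obtain ⟨d, hd, hlow⟩ := exists_seq_lower_estimate
    (P := fun _ d => ∃ w ∈ F, l1Norm w = 1 ∧ c00ToL1 w = d) one_pos (by
      intro n N η hη
      obtain ⟨v, hv, hi⟩ := exists_norm_eq_one_of_infinite hF (c00ToL1 ∘ₗ F.subtype)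
        (c00ToL1_injective.comp F.subtype_injective) N
      refine ⟨_, ⟨v, v.2, ?_, rfl⟩, hv.ge, fun i hiN => ?_⟩
      · rw [← norm_c00ToL1]; exact hv
      · have := hi i hiN
        simp only [LinearMap.comp_apply, Submodule.subtype_apply] at this
        rw [this, abs_zero]
        exact hη.le)
  choose w hwF hw1 hwd using hd
  refine ⟨w, hwF, hw1, fun a => (hlow a).trans_eq ?_⟩
  rw [← norm_c00ToL1, Finsupp.apply_linearCombination]
  congr 2
  exact congrArg (Finsupp.linearCombination ℝ) (funext fun n => (hwd n).symm)

theorem half_le_dist_of_lower_estimate {w : ℕ → ℕ →₀ ℝ}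
    (hw : ∀ a : ℕ →₀ ℝ, 1 / 2 * l1Norm a ≤ l1Norm (Finsupp.linearCombination ℝ w a))
    {m n : ℕ} (h : m ≠ n) : 1 / 2 ≤ dist (c00ToL1 (w m)) (c00ToL1 (w n)) := by
  have h1 := hw (Finsupp.single m 1 - Finsupp.single n 1)
  have h2 := abs_apply_le_l1Norm (Finsupp.single m 1 - Finsupp.single n 1) m
  rw [map_sub, Finsupp.linearCombination_single, Finsupp.linearCombination_single, one_smul,
    one_smul] at h1
  rw [Finsupp.sub_apply, Finsupp.single_eq_same, Finsupp.single_eq_of_ne h, sub_zero,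
    abs_one] at h2
  rw [dist_eq_norm, ← map_sub, norm_c00ToL1]
  linarith

namespace TwistedSum

open PreTwistedSum

variable (Φ : QuasilinearMap)

theorem not_finiteDimensional : ¬ FiniteDimensional ℝ (TwistedSum Φ) := fun _ =>
  not_finiteDimensional_c00 <| FiniteDimensional.of_injective
    ((incl Φ).toLinearMap ∘ₗ zeroPair Φ) <| by
      refine Function.Injective.of_comp (f := quotientMap Φ) ?_
      convert c00ToL1_injective using 1
      ext1 u
      exact quotientMap_incl_pair Φ 0 u

/-- Sequences in a subspace of `c₀₀` on which `Φ` is bounded define operators `ℓ₁ → Y`. -/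
theorem exists_operator_of_bounded {F : Submodule ℝ (ℕ →₀ ℝ)} {K : ℝ}
    (hK : ∀ u ∈ F, |Φ u| ≤ K * l1Norm u) {w : ℕ → ℕ →₀ ℝ} (hwF : ∀ n, w n ∈ F)
    (hw : ∀ n, l1Norm (w n) ≤ 1) :
    ∃ R : L1 →L[ℝ] TwistedSum Φ,
      ∀ a, R (c00ToL1 a) = incl Φ (pair Φ 0 (Finsupp.linearCombination ℝ w a)) := by
  refine exists_extend_c00
    ((incl Φ).toLinearMap ∘ₗ zeroPair Φ ∘ₗ Finsupp.linearCombination ℝ w) fun U hU => ?_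
  obtain ⟨ε, hε, h⟩ := exists_qnorm_lt_mem Φ hU
  refine ⟨ε / (|K| + 1), by positivity, fun a ha => h _ ?_⟩
  rw [lt_div_iff₀ (by positivity)] at ha
  rw [LinearMap.comp_apply, zeroPair_apply, qnorm_pair, zero_sub, abs_neg]
  set v := Finsupp.linearCombination ℝ w a with hv
  have hvF : v ∈ F := by
    rw [hv, Finsupp.linearCombination_apply]
    exact F.sum_mem fun n _ => F.smul_mem _ (hwF n)
  have h1 : l1Norm v ≤ l1Norm a := by
    rw [hv, ← norm_c00ToL1, Finsupp.apply_linearCombination]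
    simpa using norm_linearCombination_le (C := 1) (d := c00ToL1 ∘ w)
      (fun n => by rw [Function.comp_apply, norm_c00ToL1]; exact hw n) a
  have h2 := hK v hvF
  have h3 := l1Norm_nonneg v
  have h4 := le_abs_self K
  have h5 := abs_nonneg K
  nlinarith

theorem operator_single {w : ℕ → ℕ →₀ ℝ} {R : L1 →L[ℝ] TwistedSum Φ}
    (hR : ∀ a, R (c00ToL1 a) = incl Φ (pair Φ 0 (Finsupp.linearCombination ℝ w a))) (n : ℕ) :
    R (c00ToL1 (Finsupp.single n 1)) = incl Φ (pair Φ 0 (w n)) := by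
  rw [hR, Finsupp.linearCombination_single, one_smul]

/-- The operator sends the unit vectors to `(0, w n)`, whose images under `π` are uniformly
separated. -/
theorem exists_not_isCompactOperator {F : Submodule ℝ (ℕ →₀ ℝ)}
    (hF : ¬ FiniteDimensional ℝ F) {K : ℝ} (hK : ∀ u ∈ F, |Φ u| ≤ K * l1Norm u) :
    ∃ T : L1 →L[ℝ] TwistedSum Φ, ¬ IsCompactOperator T := by
  obtain ⟨w, hwF, hw1, hw⟩ := exists_seq_mem_lower_estimate hF
  obtain ⟨R, hR⟩ := exists_operator_of_bounded Φ hK hwF fun n => (hw1 n).le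
  refine ⟨R, ?_⟩
  rintro ⟨C, hC, hRC⟩
  obtain ⟨r, hr, hrC⟩ := Metric.nhds_basis_closedBall.mem_iff.1 hRC
  refine not_separated_of_mem_isCompact (hC.image (quotientMap Φ).continuous)
    (x := fun n => r • c00ToL1 (w n)) (fun n => ?_) (half_pos hr) fun m n hmn => ?_
  · refine ⟨_, hrC (a := r • c00ToL1 (Finsupp.single n 1)) ?_, ?_⟩
    · rw [mem_closedBall_zero_iff, norm_smul, norm_c00ToL1, l1Norm_single, abs_one, mul_one,
        Real.norm_of_nonneg hr.le]
    · rw [map_smul, map_smul, operator_single Φ hR, quotientMap_incl_pair]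
  · rw [dist_smul₀, Real.norm_of_nonneg hr.le]
    have := half_le_dist_of_lower_estimate hw hmn
    nlinarith

/-- An operator on `Y` that is not a scalar plus a compact operator: it maps onto every other
vector of a copy of the `ℓ₁`-basis. -/
theorem exists_not_scalar_add_compact {F : Submodule ℝ (ℕ →₀ ℝ)}
    (hF : ¬ FiniteDimensional ℝ F) {K : ℝ} (hK : ∀ u ∈ F, |Φ u| ≤ K * l1Norm u) :
    ∃ T : TwistedSum Φ →L[ℝ] TwistedSum Φ,
      ¬ ∃ (c : ℝ) (S : TwistedSum Φ →L[ℝ] TwistedSum Φ),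
        IsCompactOperator S ∧ T = c • ContinuousLinearMap.id ℝ (TwistedSum Φ) + S := by
  obtain ⟨w, hwF, hw1, hw⟩ := exists_seq_mem_lower_estimate hF
  -- The zeros at odd indices serve to rule out a nonzero scalar; the even indices then contradict
  -- compactness of the remainder.
  let w' : ℕ → ℕ →₀ ℝ := fun n => if Even n then w n else 0
  obtain ⟨R, hR⟩ := exists_operator_of_bounded Φ hK (w := w')
    (fun n => by by_cases h : Even n <;> simp [w', h, hwF])
    (fun n => by
      by_cases h : Even n
      · simp [w', h, hw1]
      · simp [w', h, l1Norm])
  refine ⟨R ∘L quotientMap Φ, ?_⟩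
  rintro ⟨c, S, ⟨C, hC, hSC⟩, hT⟩
  obtain ⟨ε, hε, hεC⟩ := exists_qnorm_lt_mem Φ hSC
  let r := ε / 2
  have hr : 0 < r := half_pos hε
  let e : ℕ → ℕ →₀ ℝ := fun n => Finsupp.single n 1
  -- Lifts of the unit vectors of quasinorm `1`; scaling by `r` brings them into the neighbourhood
  -- that `S` maps into `C`.
  let m : ℕ → TwistedSum Φ := fun n => incl Φ (pair Φ (Φ (e n)) (e n))
  have hm : ∀ n, S (r • m n) ∈ C := fun n => by
    have := hεC (r • pair Φ (Φ (e n)) (e n)) (by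
      rw [qnorm_smul, qnorm_pair_self, l1Norm_single, abs_one, mul_one, abs_of_pos hr]
      exact half_lt_self hε)
    rwa [map_smul] at this
  have hπm : ∀ n, quotientMap Φ (m n) = c00ToL1 (e n) := fun n => quotientMap_incl_pair Φ _ _
  have hS : ∀ n, quotientMap Φ (S (r • m n)) = r • c00ToL1 (w' n) - (r * c) • c00ToL1 (e n) := by
    intro n
    have h1 : S (r • m n) = r • R (quotientMap Φ (m n)) - (r * c) • m n := by
      have := DFunLike.congr_fun hT (r • m n)
      simp only [ContinuousLinearMap.comp_apply, add_apply, smul_apply,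
        ContinuousLinearMap.id_apply] at this
      rw [map_smul, map_smul] at this
      rw [this, smul_smul, mul_comm, add_sub_cancel_left]
    rw [h1, hπm, operator_single Φ hR, map_sub, map_smul, map_smul, quotientMap_incl_pair, hπm]
  have hKc := hC.image (quotientMap Φ).continuous
  have hc : c = 0 := by
    by_contra hc
    have hrc : 0 < |r * c| := abs_pos.2 (mul_ne_zero hr.ne' hc)
    refine not_separated_of_mem_isCompact hKc
      (x := fun k => -((r * c) • c00ToL1 (e (2 * k + 1)))) (fun k => ?_) hrc
      fun k l hkl => ?_
    · refine ⟨_, hm (2 * k + 1), ?_⟩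
      have : w' (2 * k + 1) = 0 := if_neg (by simp)
      rw [hS, this, map_zero, smul_zero, zero_sub]
    · rw [dist_neg_neg, dist_smul₀, Real.norm_eq_abs, dist_eq_norm, ← map_sub, norm_c00ToL1]
      have := abs_apply_le_l1Norm (e (2 * k + 1) - e (2 * l + 1)) (2 * k + 1)
      have hne : 2 * k + 1 ≠ 2 * l + 1 := by omega
      rw [Finsupp.sub_apply, Finsupp.single_eq_same, Finsupp.single_eq_of_ne hne, sub_zero,
        abs_one] at this
      nlinarith
  refine not_separated_of_mem_isCompact hKc
    (x := fun k => r • c00ToL1 (w (2 * k))) (fun k => ?_) (half_pos hr) fun k l hkl => ?_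
  · refine ⟨_, hm (2 * k), ?_⟩
    have : w' (2 * k) = w (2 * k) := if_pos (by simp)
    rw [hS, this, hc, mul_zero, zero_smul, sub_zero]
  · rw [dist_smul₀, Real.norm_of_nonneg hr.le]
    have := half_le_dist_of_lower_estimate hw (show 2 * k ≠ 2 * l by omega)
    nlinarith

/-- `π ∘ R` is bounded below, so `R` is an isomorphism of `ℓ₁` onto a closed subspace of `Y` and
carries the unit vector basis to a basic sequence. -/
theorem exists_isBasicSequence {F : Submodule ℝ (ℕ →₀ ℝ)}
    (hF : ¬ FiniteDimensional ℝ F) {K : ℝ} (hK : ∀ u ∈ F, |Φ u| ≤ K * l1Norm u) :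
    ∃ x : ℕ → TwistedSum Φ, IsBasicSequence x := by
  obtain ⟨w, hwF, hw1, hw⟩ := exists_seq_mem_lower_estimate hF
  obtain ⟨R, hR⟩ := exists_operator_of_bounded Φ hK hwF fun n => (hw1 n).le
  let Q : L1 →L[ℝ] L1 := quotientMap Φ ∘L R
  have hQ : ∀ a : L1, ‖a‖ ≤ 2 * ‖Q a‖ := by
    intro a
    refine denseRange_c00ToL1.induction_on a (isClosed_le (by fun_prop) (by fun_prop))
      fun u => ?_
    have h1 : Q (c00ToL1 u) = c00ToL1 (Finsupp.linearCombination ℝ w u) := by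
      rw [ContinuousLinearMap.comp_apply, hR, quotientMap_incl_pair]
    rw [h1, norm_c00ToL1, norm_c00ToL1]
    linarith [hw u]
  have hanti : AntilipschitzWith 2 Q := AddMonoidHomClass.antilipschitz_of_bound Q hQ
  have hind : IsUniformInducing R := IsUniformInducing.of_comp R.uniformContinuous
    (quotientMap Φ).uniformContinuous (hanti.isUniformInducing Q.uniformContinuous)
  have hRcl : IsClosed (LinearMap.range R.toLinearMap : Set (TwistedSum Φ)) := by
    rw [LinearMap.coe_range]
    exact hind.isComplete_range.isClosed
  let e : ℕ → L1 := fun n => c00ToL1 (Finsupp.single n 1)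
  let x : ℕ → TwistedSum Φ := fun n => R (e n)
  have hsub : closedSpan x ≤ LinearMap.range R.toLinearMap := by
    refine Submodule.topologicalClosure_minimal _ (Submodule.span_le.2 ?_) hRcl
    rintro _ ⟨n, rfl⟩
    exact ⟨e n, rfl⟩
  let g := ContinuousLinearMap.equivRange (f := Q) hanti.injective
    (hanti.isClosed_range Q.uniformContinuous)
  have hmem : ∀ y : closedSpan x, (quotientMap Φ ∘L (closedSpan x).subtypeL) y ∈
      LinearMap.range Q.toLinearMap := by
    intro y
    obtain ⟨a, ha⟩ := hsub y.2
    exact ⟨a, congrArg (quotientMap Φ) ha⟩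
  -- The inverse of `R` on the closed span, computed by applying `π` and then inverting `Q = π ∘ R`
  -- on its range.
  let T : closedSpan x →L[ℝ] L1 := (g.symm : LinearMap.range Q.toLinearMap →L[ℝ] L1) ∘L
    (quotientMap Φ ∘L (closedSpan x).subtypeL).codRestrict _ hmem
  have hT : ∀ (a : L1) (h : R a ∈ closedSpan x), T ⟨R a, h⟩ = a := by
    intro a h
    change g.symm _ = a
    rw [ContinuousLinearEquiv.symm_apply_eq]
    rfl
  refine ⟨x, fun i => lp.evalCLM ℝ (fun _ : ℕ => ℝ) 1 i ∘L T, fun i j h => ?_, fun y => ?_⟩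
  · have h1 : (lp.evalCLM ℝ (fun _ : ℕ => ℝ) 1 i ∘L T) ⟨x j, h⟩ = e j i :=
      congrArg (fun a : L1 => a i) (hT (e j) h)
    rw [h1, c00ToL1_apply, Finsupp.single_apply]
    simp only [eq_comm]
  · obtain ⟨a, ha⟩ := hsub y.2
    have hy : T y = a := by
      obtain ⟨y, hy⟩ := y
      obtain rfl : R a = y := ha
      exact hT a hy
    have h1 := ((R.continuous.tendsto a).comp (hasSum_c00ToL1_single a).tendsto_sum_nat)
    have ha' : R a = y := ha
    rw [ha'] at h1
    refine h1.congr fun n => ?_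
    rw [Function.comp_apply, map_sum]
    refine Finset.sum_congr rfl fun i _ => ?_
    have h2 : (lp.evalCLM ℝ (fun _ : ℕ => ℝ) 1 i ∘L T) y = a i :=
      congrArg (fun a : L1 => a i) hy
    rw [h2, ← map_smul, ← map_smul, Finsupp.smul_single, smul_eq_mul, mul_one]

end TwistedSum

/-! ### Basic sequences, subspaces missing `e₀` and perturbation into `c₀₀` -/

namespace TwistedSum

open PreTwistedSum

variable (Φ : QuasilinearMap)

/-- A basic sequence has a tail whose closed span misses `e₀`. -/
theorem exists_e0_notMem_of_isBasicSequence {x : ℕ → TwistedSum Φ} (hx : IsBasicSequence x) :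
    ∃ Y₀ : Submodule ℝ (TwistedSum Φ), IsClosed (Y₀ : Set (TwistedSum Φ)) ∧
      ¬ FiniteDimensional ℝ Y₀ ∧ e0 Φ ∉ Y₀ := by
  obtain ⟨coord, hc, hlim⟩ := hx
  let X := closedSpan x
  have hXcl : IsClosed (X : Set (TwistedSum Φ)) := Submodule.isClosed_topologicalClosure _
  have hxX : ∀ n, x n ∈ X := fun n =>
    Submodule.le_topologicalClosure _ (Submodule.subset_span ⟨n, rfl⟩)
  -- The tail is taken as the common kernel of the first `n` coordinates; this makes it closed, and
  -- it contains all later `x i`.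
  let T : ℕ → Submodule ℝ X := fun n => ⨅ i ∈ Finset.range n, LinearMap.ker (coord i).toLinearMap
  have hT : ∀ n (y : X), y ∈ T n ↔ ∀ i < n, coord i y = 0 := by
    intro n y
    simp [T]
  have hTcl : ∀ n, IsClosed ((T n).map X.subtype : Set (TwistedSum Φ)) := by
    intro n
    have h1 : IsClosed (T n : Set X) := by
      have : (T n : Set X) = ⋂ i ∈ Finset.range n, {y | coord i y = 0} := by
        ext y
        rw [SetLike.mem_coe, hT]
        simp only [Set.mem_iInter, Finset.mem_range]
        rfl
      rw [this]
      exact isClosed_biInter fun i _ => isClosed_eq (coord i).continuous continuous_const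
    rw [Submodule.map_coe]
    exact hXcl.isClosedEmbedding_subtypeVal.isClosedMap _ h1
  have hTinf : ∀ n, ¬ FiniteDimensional ℝ ((T n).map X.subtype) := by
    intro n hfin
    have hmem : ∀ i, (⟨x (n + i), hxX _⟩ : X) ∈ T n := fun i =>
      (hT n _).2 fun j hj => by rw [hc, if_neg (by omega)]
    let q : (ℕ →₀ ℝ) →ₗ[ℝ] X :=
      Finsupp.linearCombination ℝ fun i => (⟨x (n + i), hxX _⟩ : X)
    have hq : ∀ a i, coord (n + i) (q a) = a i := by
      intro a i
      have : (fun j => coord (n + i) (⟨x (n + j), hxX _⟩ : X)) =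
          fun j => if i = j then (1 : ℝ) else 0 := by
        ext j
        rw [hc]
        simp
      change (coord (n + i)).toLinearMap (q a) = a i
      rw [Finsupp.apply_linearCombination, Finsupp.linearCombination_apply, Finsupp.sum]
      change ∑ j ∈ a.support, a j • (fun j => coord (n + i) (⟨x (n + j), hxX _⟩ : X)) j = a i
      rw [this]
      simp +contextual
    have hqT : ∀ a, X.subtype (q a) ∈ (T n).map X.subtype := fun a =>
      Submodule.mem_map_of_mem (by
        simp only [q, Finsupp.linearCombination_apply]
        exact (T n).sum_mem fun i _ => (T n).smul_mem _ (hmem i))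
    refine not_finiteDimensional_c00 (FiniteDimensional.of_injective
      ((X.subtype ∘ₗ q).codRestrict _ hqT) fun a b hab => ?_)
    have hab' : X.subtype (q a) = X.subtype (q b) :=
      congrArg ((T n).map X.subtype).subtype hab
    ext i
    rw [← hq a, X.subtype_injective hab', hq]
  by_contra! hall
  have hall' : ∀ n, e0 Φ ∈ (T n).map X.subtype := fun n => hall _ (hTcl n) (hTinf n)
  have heX : e0 Φ ∈ X := by
    obtain ⟨y, -, hy⟩ := hall' 0
    rw [← hy]
    exact y.2
  have h0 : ∀ i, coord i ⟨e0 Φ, heX⟩ = 0 := by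
    intro i
    obtain ⟨y, hy, hye⟩ := hall' (i + 1)
    have : y = ⟨e0 Φ, heX⟩ := Subtype.ext hye
    rw [← this]
    exact (hT _ _).1 hy i (Nat.lt_succ_self i)
  have h := hlim ⟨e0 Φ, heX⟩
  simp only [h0, zero_smul, Finset.sum_const_zero] at h
  exact e0_ne_zero Φ (tendsto_nhds_unique h tendsto_const_nhds)

theorem isEmbedding_quotientMap_iff (Y₀ : Submodule ℝ (TwistedSum Φ)) :
    IsEmbedding (fun y : Y₀ => quotientMap Φ y) ↔
      ∀ U ∈ 𝓝 (0 : TwistedSum Φ), ∃ η : ℝ, 0 < η ∧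
        ∀ y ∈ Y₀, ‖quotientMap Φ y‖ < η → y ∈ U := by
  let p : Y₀ →L[ℝ] L1 := quotientMap Φ ∘L Y₀.subtypeL
  have hp : IsInducing p ↔ 𝓝 0 = comap p (𝓝 0) :=
    IsTopologicalAddGroup.isInducing_iff_nhds_zero
  change IsEmbedding p ↔ _
  constructor
  · intro h U hU
    have h1 : (Subtype.val : Y₀ → TwistedSum Φ) ⁻¹' U ∈ 𝓝 (0 : Y₀) :=
      continuous_subtype_val.continuousAt.preimage_mem_nhds hU
    rw [hp.1 h.isInducing, (Metric.nhds_basis_ball.comap _).mem_iff] at h1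
    obtain ⟨η, hη, h1⟩ := h1
    exact ⟨η, hη, fun y hy hyη => h1 (a := ⟨y, hy⟩) (mem_ball_zero_iff.2 hyη)⟩
  · intro h
    have hind : IsInducing p := by
      refine hp.2 (le_antisymm ?_ ?_)
      · have := p.continuous.tendsto 0
        rw [map_zero] at this
        exact this.le_comap
      · rw [nhds_subtype_eq_comap]
        rintro s ⟨U, hU, hUs⟩
        obtain ⟨η, hη, hηU⟩ := h U hU
        refine ⟨Metric.ball 0 η, Metric.ball_mem_nhds 0 hη, fun y hy => hUs ?_⟩
        exact hηU y y.2 (mem_ball_zero_iff.1 hy)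
    exact hind.isEmbedding

/-- If `π y` is small, then `y` is `c • e₀` plus a small vector. A large `c` would make `c⁻¹ • y`,
an element of `Y₀`, close to `e₀`, which closedness forbids. Hence `c` is small, and so is `y`. -/
theorem isEmbedding_quotientMap_of_e0_notMem {Y₀ : Submodule ℝ (TwistedSum Φ)}
    (hcl : IsClosed (Y₀ : Set (TwistedSum Φ))) (he : e0 Φ ∉ Y₀) :
    IsEmbedding (fun y : Y₀ => quotientMap Φ y) := by
  rw [isEmbedding_quotientMap_iff]
  intro U hU
  obtain ⟨V, hV, hVb, hVU⟩ := exists_balanced_add_mem hU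
  have hW : (fun w => e0 Φ + w) ⁻¹' (Y₀ : Set (TwistedSum Φ))ᶜ ∈ 𝓝 (0 : TwistedSum Φ) := by
    refine (continuous_const_add (e0 Φ)).continuousAt.preimage_mem_nhds ?_
    rw [add_zero]
    exact hcl.isOpen_compl.mem_nhds he
  obtain ⟨W, ⟨hW, hWb⟩, hWY⟩ := (nhds_basis_balanced ℝ (TwistedSum Φ)).mem_iff.1 hW
  obtain ⟨δ, hδ, hδV⟩ := exists_pos_smul_mem hV (e0 Φ)
  have hδW : {w | δ⁻¹ • w ∈ W} ∈ 𝓝 (0 : TwistedSum Φ) := by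
    refine (continuous_const_smul δ⁻¹).continuousAt.preimage_mem_nhds ?_
    rwa [smul_zero]
  obtain ⟨η, hη, h⟩ := exists_sub_smul_e0_mem Φ (inter_mem hV hδW)
  refine ⟨η, hη, fun y hy hyη => ?_⟩
  obtain ⟨c, hcV, hcW⟩ := h y hyη
  have hc : |c| ≤ δ := by
    by_contra! hlt
    have hc0 : c ≠ 0 := by
      rintro rfl
      rw [abs_zero] at hlt
      linarith
    have h1 : (δ / c) • δ⁻¹ • (y - c • e0 Φ) ∈ W :=
      hWb.smul_mem_of_abs_le_one (by
        rw [abs_div, abs_of_pos hδ]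
        exact (div_le_one (by linarith)).2 hlt.le) hcW
    refine hWY h1 ?_
    have h2 : e0 Φ + (δ / c) • δ⁻¹ • (y - c • e0 Φ) = c⁻¹ • y := by
      rw [smul_smul, show δ / c * δ⁻¹ = c⁻¹ by field_simp, smul_sub, smul_smul,
        inv_mul_cancel₀ hc0, one_smul]
      abel
    change e0 Φ + (δ / c) • δ⁻¹ • (y - c • e0 Φ) ∈ Y₀
    rw [h2]
    exact Y₀.smul_mem _ hy
  have := hVU _ hcV _ (hδV c hc)
  rwa [sub_add_cancel] at this

/-- Perturbation: an infinite-dimensional subspace embedded by the quotient map yields an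
infinite-dimensional subspace of `c₀₀` on which `Φ` is bounded. -/
theorem exists_bounded_of_isEmbedding {Y₀ : Submodule ℝ (TwistedSum Φ)}
    (hinf : ¬ FiniteDimensional ℝ Y₀) (hemb : IsEmbedding (fun y : Y₀ => quotientMap Φ y)) :
    ∃ F : Submodule ℝ (ℕ →₀ ℝ), ¬ FiniteDimensional ℝ F ∧
      ∃ K : ℝ, ∀ u ∈ F, |Φ u| ≤ K * l1Norm u := by
  obtain ⟨d, hd, hlow⟩ := exists_seq_lower_estimate
    (P := fun _ d => ∃ y ∈ Y₀, quotientMap Φ y = d ∧ ‖d‖ = 1) one_pos (by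
      intro n N η hη
      obtain ⟨v, hv, hi⟩ := exists_norm_eq_one_of_infinite hinf
        ((quotientMap Φ).toLinearMap ∘ₗ Y₀.subtype) hemb.injective N
      refine ⟨_, ⟨v, v.2, rfl, hv⟩, hv.ge, fun i hiN => ?_⟩
      have h : quotientMap Φ v i = 0 := hi i hiN
      rw [h, abs_zero]
      exact hη.le)
  choose y hyY hyd hd1 using hd
  rw [isEmbedding_quotientMap_iff] at hemb
  obtain ⟨U, hU, hUq⟩ := exists_mem_nhds_qnorm_lt Φ one_pos
  obtain ⟨U₀, hU₀, -, hU₀U⟩ := exists_balanced_add_mem hU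
  -- The `n`-th approximation error is placed in `V n`, so that all combinations with coefficients
  -- at most `1` have total error in `U₀`.
  obtain ⟨V, hV, hVU⟩ := exists_seq_sum_mem hU₀
  obtain ⟨η, hη, hηU⟩ := hemb U₀ hU₀
  -- Errors below `1 / 4` in `ℓ₁` leave the lower constant `1 / 4` out of the `1 / 2` available for
  -- `d`.
  have hz : ∀ n, ∃ α u, incl Φ (pair Φ α u) - y n ∈ V n ∧ ‖c00ToL1 u - d n‖ < 1 / 4 := by
    intro n
    have hcont : Continuous fun z => z - y n := by fun_prop
    have h1 : {z | z - y n ∈ V n} ∈ 𝓝 (y n) :=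
      hcont.continuousAt.preimage_mem_nhds (by rw [sub_self]; exact hV n)
    have h2 : {z | ‖quotientMap Φ z - d n‖ < 1 / 4} ∈ 𝓝 (y n) := by
      refine (isOpen_lt (by fun_prop) continuous_const).mem_nhds ?_
      rw [Set.mem_ofPred_eq, hyd, sub_self, norm_zero]
      norm_num
    obtain ⟨_, ⟨hz1, hz2⟩, z, rfl⟩ :=
      mem_closure_iff_nhds.1 (denseRange_incl Φ (y n)) _ (inter_mem h1 h2)
    obtain ⟨α, u, rfl⟩ := exists_eq_pair Φ z
    rw [Set.mem_ofPred_eq, quotientMap_incl_pair] at hz2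
    exact ⟨α, u, hz1, hz2⟩
  choose α u hzV hud using hz
  let q := Finsupp.linearCombination ℝ u
  let f := Finsupp.linearCombination ℝ α
  have hpair : ∀ a, Finsupp.linearCombination ℝ (fun n => incl Φ (pair Φ (α n) (u n))) a =
      incl Φ (pair Φ (f a) (q a)) := by
    intro a
    have h1 : Finsupp.linearCombination ℝ (fun n => (α n, u n)) a = (f a, q a) := by
      ext1
      · exact Finsupp.apply_linearCombination ℝ (LinearMap.fst ℝ ℝ (ℕ →₀ ℝ)) _ a
      · exact Finsupp.apply_linearCombination ℝ (LinearMap.snd ℝ ℝ (ℕ →₀ ℝ)) _ a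
    change _ = incl Φ ((toProd Φ).symm (f a, q a))
    rw [← h1]
    exact (Finsupp.apply_linearCombination ℝ
      ((incl Φ).toLinearMap ∘ₗ (toProd Φ).symm.toLinearMap) _ a).symm
  have hq : ∀ a, 1 / 4 * l1Norm a ≤ l1Norm (q a) := by
    intro a
    have h1 : c00ToL1 (q a) = Finsupp.linearCombination ℝ d a +
        Finsupp.linearCombination ℝ (fun n => c00ToL1 (u n) - d n) a := by
      rw [Finsupp.apply_linearCombination]
      simp only [Finsupp.linearCombination_apply, Finsupp.sum, Function.comp_apply, smul_sub,
        Finset.sum_sub_distrib]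
      abel
    have h2 := norm_linearCombination_le (fun n => (hud n).le) a
    have h3 := norm_sub_le (c00ToL1 (q a))
      (Finsupp.linearCombination ℝ (fun n => c00ToL1 (u n) - d n) a)
    rw [h1, add_sub_cancel_right, ← h1, norm_c00ToL1] at h3
    linarith [hlow a]
  have hqinj : Function.Injective q := by
    rw [injective_iff_map_eq_zero]
    intro a ha
    have h1 := hq a
    rw [ha] at h1
    ext i
    have h2 := abs_apply_le_l1Norm a i
    have h3 : l1Norm 0 = 0 := by simp [l1Norm]
    have h4 := abs_nonneg (a i)
    rw [Finsupp.zero_apply, ← abs_eq_zero]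
    linarith
  -- On the kernel of `f` the first components cancel and combinations are `(0, q a)`, whose
  -- quasinorm dominates `|Φ (q a)|`; the kernel has codimension at most one. The constant comes
  -- from scaling `a` to norm `r / 2`, where `r = min η 1`, and from `‖a‖₁ ≤ 4 ‖q a‖₁`.
  refine ⟨(LinearMap.ker f).map q, fun hfin => ?_, 8 * (min η 1)⁻¹, ?_⟩
  · have h1 : FiniteDimensional ℝ (LinearMap.ker f) :=
      Module.Finite.equiv (Submodule.equivMapOfInjective q hqinj (LinearMap.ker f)).symm
    refine not_finiteDimensional_c00 ⟨Submodule.fg_of_fg_map_of_fg_inf_ker f ?_ ?_⟩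
    · exact IsNoetherian.noetherian _
    · rw [top_inf_eq]
      exact Module.Finite.iff_fg.1 h1
  · rintro _ ⟨a, ha, rfl⟩
    have key : ∀ a ∈ LinearMap.ker f, l1Norm a < min η 1 → |Φ (q a)| ≤ 1 := by
      intro a ha haη
      rw [LinearMap.mem_ker] at ha
      have h1 : Finsupp.linearCombination ℝ y a ∈ U₀ := by
        refine hηU _ ?_ ?_
        · rw [Finsupp.linearCombination_apply]
          exact Y₀.sum_mem fun n _ => Y₀.smul_mem _ (hyY n)
        · have h2 : quotientMap Φ (Finsupp.linearCombination ℝ y a) =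
              Finsupp.linearCombination ℝ d a := by
            rw [show d = (quotientMap Φ).toLinearMap ∘ y from funext fun n => (hyd n).symm]
            exact Finsupp.apply_linearCombination ℝ (quotientMap Φ).toLinearMap y a
          rw [h2]
          have h3 := norm_linearCombination_le (fun n => (hd1 n).le) a
          have h4 := min_le_left η 1
          linarith
      have h2 := hVU _ hzV a fun n =>
        (abs_apply_le_l1Norm a n).trans (haη.le.trans (min_le_right _ _))
      have h3 := hU₀U _ h1 _ h2
      have h4 : Finsupp.linearCombination ℝ y a +
          Finsupp.linearCombination ℝ (fun n => incl Φ (pair Φ (α n) (u n)) - y n) a =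
          incl Φ (pair Φ 0 (q a)) := by
        rw [← ha, ← hpair]
        simp only [Finsupp.linearCombination_apply, Finsupp.sum, smul_sub,
          Finset.sum_sub_distrib]
        abel
      rw [h4] at h3
      have h5 := hUq _ h3
      rw [qnorm_pair, zero_sub, abs_neg] at h5
      linarith [l1Norm_nonneg (q a)]
    set r := min η 1
    have hr : 0 < r := lt_min hη one_pos
    have ha0 := l1Norm_nonneg a
    rcases ha0.eq_or_lt with h0 | h0
    · have ha' : a = 0 := by
        ext i
        have := abs_apply_le_l1Norm a i
        rw [← h0] at this
        simpa using this
      have hΦ : Φ 0 = 0 := by simpa using Φ.map_smul' 0 0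
      rw [ha', map_zero, hΦ, abs_zero]
      have := l1Norm_nonneg 0
      positivity
    · have h1 := key ((r / (2 * l1Norm a)) • a) (Submodule.smul_mem _ _ ha) (by
        rw [l1Norm_smul, abs_of_pos (by positivity), div_mul_eq_mul_div,
          div_lt_iff₀ (by positivity)]
        nlinarith)
      rw [map_smul, Φ.map_smul', abs_mul, abs_of_pos (by positivity), div_mul_eq_mul_div,
        div_le_one (by positivity)] at h1
      have h2 := hq a
      rw [show 8 * r⁻¹ * l1Norm (q a) = 8 * l1Norm (q a) / r by ring, le_div_iff₀ hr]
      linarith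

end TwistedSum

/-! ### Topological minimality and compactness of operators -/

namespace TwistedSum

open PreTwistedSum

variable (Φ : QuasilinearMap)

/-- The quotient by `Y₀` and the coordinates of `π` together separate points, because `π` is
injective on `Y₀`. In the topology they induce, vectors of `Y₀` with `‖π x‖ = 1` and more and more
vanishing initial coordinates tend to `0`; in the original topology they do not. -/
theorem not_isTopologicallyMinimal {Y₀ : Submodule ℝ (TwistedSum Φ)}
    (hcl : IsClosed (Y₀ : Set (TwistedSum Φ))) (hinf : ¬ FiniteDimensional ℝ Y₀)
    (he : e0 Φ ∉ Y₀) : ¬ IsTopologicallyMinimal (TwistedSum Φ) := by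
  intro hmin
  have hker : ∀ y ∈ Y₀, quotientMap Φ y = 0 → y = 0 := by
    intro y hy hy0
    obtain ⟨c, rfl⟩ := exists_eq_smul_e0 Φ hy0
    by_cases hc : c = 0
    · rw [hc, zero_smul]
    · refine (he ?_).elim
      simpa [smul_smul, inv_mul_cancel₀ hc] using Y₀.smul_mem c⁻¹ hy
  have : IsClosed (Y₀ : Set (TwistedSum Φ)) := hcl
  let J : TwistedSum Φ →L[ℝ] (TwistedSum Φ ⧸ Y₀) × (ℕ → ℝ) :=
    (Y₀.mkQL).prod
      (ContinuousLinearMap.pi fun i => lp.evalCLM ℝ (fun _ : ℕ => ℝ) 1 i ∘L quotientMap Φ)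
  have hJ1 : ∀ y, (J y).1 = Submodule.Quotient.mk y := fun _ => rfl
  have hJ2 : ∀ y i, (J y).2 i = quotientMap Φ y i := fun _ _ => rfl
  have hJ : Function.Injective J := by
    rw [injective_iff_map_eq_zero]
    intro y hy
    refine hker y ?_ ?_
    · rw [← Submodule.Quotient.mk_eq_zero, ← hJ1, hy]
      rfl
    · ext i
      rw [← hJ2, hy]
      rfl
  have hτ := hmin (TopologicalSpace.induced J inferInstance) (topologicalAddGroup_induced J)
    (continuousSMul_induced J.toLinearMap)
    (@T2Space.of_injective_continuous _ _ (TopologicalSpace.induced J inferInstance) _ _ J hJ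
      continuous_induced_dom)
    J.continuous.le_induced
  have hind : IsInducing J := ⟨hτ.symm⟩
  choose x hx1 hxi using exists_norm_eq_one_of_infinite hinf
    ((quotientMap Φ).toLinearMap ∘ₗ Y₀.subtype) (by
      rw [injective_iff_map_eq_zero]
      exact fun y hy => Subtype.ext (hker y y.2 hy))
  have hlim : Tendsto (fun n => J (x n)) atTop (𝓝 (J 0)) := by
    rw [map_zero]
    refine Tendsto.prodMk_nhds ?_ (tendsto_pi_nhds.2 fun i => ?_)
    · refine tendsto_const_nhds.congr fun n => ?_
      exact ((Submodule.Quotient.mk_eq_zero Y₀).2 (x n).2).symm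
    · refine tendsto_const_nhds.congr' ?_
      filter_upwards [eventually_gt_atTop i] with n hn
      exact (hxi n i hn).symm
  have hlim' : Tendsto (fun n => ((x n : Y₀) : TwistedSum Φ)) atTop (𝓝 0) :=
    hind.tendsto_nhds_iff.2 hlim
  have h1 := ((quotientMap Φ).continuous.tendsto 0).comp hlim'
  rw [map_zero, tendsto_zero_iff_norm_tendsto_zero] at h1
  have h2 : (fun n => ‖((quotientMap Φ) ∘ fun n => ((x n : Y₀) : TwistedSum Φ)) n‖) =
    fun _ => (1 : ℝ) := funext hx1
  rw [h2] at h1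
  exact one_ne_zero (tendsto_nhds_unique tendsto_const_nhds h1)

/-- A sequence with a lower `ℓ₁`-estimate in the quotient, small combinations of which stay away
from `e₀`, spans a closed subspace missing `e₀`. -/
theorem exists_e0_notMem_of_lower_estimate {y : ℕ → TwistedSum Φ} {c : ℝ} (hc : 0 < c)
    (hlow : ∀ a : ℕ →₀ ℝ, c * l1Norm a ≤
      ‖Finsupp.linearCombination ℝ (fun n => quotientMap Φ (y n)) a‖)
    {U : Set (TwistedSum Φ)} (hU : e0 Φ ∉ closure U) {η : ℝ} (hη : 0 < η)
    (h : ∀ a : ℕ →₀ ℝ, l1Norm a < η → Finsupp.linearCombination ℝ y a ∈ U) :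
    ∃ Y₀ : Submodule ℝ (TwistedSum Φ), IsClosed (Y₀ : Set (TwistedSum Φ)) ∧
      ¬ FiniteDimensional ℝ Y₀ ∧ e0 Φ ∉ Y₀ := by
  have hπ : ∀ a, quotientMap Φ (Finsupp.linearCombination ℝ y a) =
      Finsupp.linearCombination ℝ (fun n => quotientMap Φ (y n)) a := fun a =>
    Finsupp.apply_linearCombination ℝ (quotientMap Φ).toLinearMap y a
  let G := LinearMap.range (Finsupp.linearCombination ℝ y)
  refine ⟨G.topologicalClosure, G.isClosed_topologicalClosure, fun hfin => ?_, ?_⟩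
  · refine not_finiteDimensional_c00 (FiniteDimensional.of_injective
      ((Finsupp.linearCombination ℝ y).codRestrict G.topologicalClosure
        fun a => G.le_topologicalClosure ⟨a, rfl⟩) ?_)
    rw [injective_iff_map_eq_zero]
    intro a ha
    have ha' : Finsupp.linearCombination ℝ y a = 0 := congrArg Subtype.val ha
    have h1 := hlow a
    rw [← hπ, ha', map_zero, norm_zero] at h1
    ext i
    have h2 := abs_apply_le_l1Norm a i
    have h3 := abs_nonneg (a i)
    rw [Finsupp.zero_apply, ← abs_eq_zero]
    nlinarith
  · refine e0_notMem_closure Φ (mul_pos hc hη) hU ?_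
    rintro _ ⟨a, rfl⟩ ha
    refine h a ?_
    rw [hπ] at ha
    exact lt_of_mul_lt_mul_left ((hlow a).trans_lt ha) hc.le

theorem isVonNBounded_image_qnorm_le (r : ℝ) :
    Bornology.IsVonNBounded ℝ (incl Φ '' {x | qnorm Φ x ≤ r}) := by
  intro U hU
  obtain ⟨ε, hε, h⟩ := exists_qnorm_lt_mem Φ hU
  refine Absorbs.of_norm ⟨(|r| + 1) / ε, fun c hc => ?_⟩
  have hc0 : 0 < ‖c‖ := lt_of_lt_of_le (by positivity) hc
  rintro _ ⟨x, hx, rfl⟩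
  have hx' : qnorm Φ x ≤ r := hx
  refine ⟨c⁻¹ • incl Φ x, ?_, smul_inv_smul₀ (norm_pos_iff.1 hc0) _⟩
  rw [← map_smul]
  refine h _ ?_
  rw [qnorm_smul, abs_inv, inv_mul_eq_div, ← Real.norm_eq_abs, div_lt_iff₀ hc0]
  rw [div_le_iff₀ hε] at hc
  linarith [le_abs_self r]

/-- If every closed infinite-dimensional subspace contains `e₀`, then vectors with small image
under a continuous linear injection have bounded image in `ℓ₁`. -/
theorem exists_norm_proj_lt_one
    (h : ∀ Y₀ : Submodule ℝ (TwistedSum Φ), IsClosed (Y₀ : Set (TwistedSum Φ)) →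
      ¬ FiniteDimensional ℝ Y₀ → e0 Φ ∈ Y₀)
    {Z : Type*} [AddCommGroup Z] [Module ℝ Z] [TopologicalSpace Z] [IsTopologicalAddGroup Z]
    [ContinuousSMul ℝ Z] [T2Space Z] (J : TwistedSum Φ →L[ℝ] Z) (hJ : Function.Injective J) :
    ∃ V ∈ 𝓝 (0 : Z), ∀ x, J (incl Φ x) ∈ V → ‖proj Φ x‖ < 1 := by
  by_contra! hcon
  have hne : (comap (fun x => J (incl Φ x)) (𝓝 0) ⊓ 𝓟 {x | ‖proj Φ x‖ = 1}).NeBot := by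
    rw [inf_principal_neBot_iff]
    rintro s ⟨V, hV, hVs⟩
    obtain ⟨W, ⟨hW, hWb⟩, hWV⟩ := (nhds_basis_balanced ℝ Z).mem_iff.1 hV
    obtain ⟨x, hxW, hx⟩ := hcon W hW
    have hx0 : 0 < ‖proj Φ x‖ := by linarith
    refine ⟨‖proj Φ x‖⁻¹ • x, hVs (hWV ?_), ?_⟩
    · change J (incl Φ _) ∈ W
      rw [map_smul, map_smul]
      refine hWb.smul_mem_of_abs_le_one ?_ hxW
      rw [abs_inv, abs_norm]
      exact inv_le_one_of_one_le₀ hx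
    · rw [Set.mem_ofPred_eq, map_smul, norm_smul, norm_inv, norm_norm, inv_mul_cancel₀ hx0.ne']
  let 𝒰 := Ultrafilter.of (comap (fun x => J (incl Φ x)) (𝓝 0) ⊓ 𝓟 {x | ‖proj Φ x‖ = 1})
  have h𝒰 := Ultrafilter.of_le (comap (fun x => J (incl Φ x)) (𝓝 0) ⊓ 𝓟 {x | ‖proj Φ x‖ = 1})
  have hlim : Tendsto (fun x => J (incl Φ x)) 𝒰 (𝓝 0) :=
    tendsto_iff_comap.2 (h𝒰.trans inf_le_left)
  have hnorm : ∀ᶠ x in 𝒰, ‖proj Φ x‖ = 1 := (h𝒰.trans inf_le_right) (mem_principal_self _)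
  -- Split `x` into a bounded lift `s x` of its image and a multiple of `e₀`. If the images were
  -- Cauchy, `s` would converge to some `l`, and `J l` would lie on the line through `J e₀`. Then `π
  -- l = 0`, although the images have norm one.
  have hnc : ¬ Cauchy (map (fun x => proj Φ x) 𝒰) := by
    intro hC
    let c : PreTwistedSum Φ → ℝ := fun x => (toProd Φ x).1 - Φ (toProd Φ x).2
    let s : PreTwistedSum Φ → TwistedSum Φ := fun x =>
      incl Φ (pair Φ (Φ (toProd Φ x).2) (toProd Φ x).2)
    have hs : ∀ x, incl Φ x = s x + c x • e0 Φ := by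
      intro x
      have : x = pair Φ (Φ (toProd Φ x).2) (toProd Φ x).2 + c x • pair Φ 1 0 := by
        rw [← sub_eq_iff_eq_add]
        change pair Φ (toProd Φ x).1 (toProd Φ x).2 - _ = _
        rw [pair_sub_smul]
        simp only [c, sub_sub_cancel]
      conv_lhs => rw [this, map_add, map_smul]
      rfl
    have hsπ : ∀ x, quotientMap Φ (s x) = proj Φ x := fun x => quotientMap_incl_pair Φ _ _
    have hsC := cauchy_of_cauchy_quotientMap Φ 𝒰 s (isVonNBounded_image_qnorm_le Φ 1) (by
      filter_upwards [hnorm] with x hx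
      refine ⟨_, ?_, rfl⟩
      rw [Set.mem_ofPred_eq, qnorm_pair_self, ← norm_c00ToL1]
      exact hx.le) (by simpa only [hsπ] using hC)
    obtain ⟨l, hl⟩ := CompleteSpace.complete hsC
    have hl : Tendsto s 𝒰 (𝓝 l) := hl
    have hcJ : Tendsto (fun x => c x • J (e0 Φ)) 𝒰 (𝓝 (-J l)) := by
      have h1 := hlim.sub ((J.continuous.tendsto l).comp hl)
      rw [zero_sub] at h1
      refine h1.congr fun x => ?_
      rw [Function.comp_apply, hs, map_add, map_smul, add_sub_cancel_left]
    have hmem := (Submodule.span ℝ {J (e0 Φ)}).closed_of_finiteDimensional.mem_of_tendsto hcJ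
      (Eventually.of_forall fun x =>
        Submodule.smul_mem _ _ (Submodule.mem_span_singleton_self _))
    obtain ⟨b, hb⟩ := Submodule.mem_span_singleton.1 hmem
    have hlb : l = -(b • e0 Φ) := hJ (by rw [map_neg, map_smul, hb, neg_neg])
    have h1 : quotientMap Φ l = 0 := by
      rw [hlb, map_neg, map_smul, quotientMap_e0, smul_zero, neg_zero]
    have h2 := (((quotientMap Φ).continuous.tendsto l).comp hl).norm
    rw [h1, norm_zero] at h2
    have h3 : Tendsto (fun _ : PreTwistedSum Φ => (1 : ℝ)) 𝒰 (𝓝 0) := by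
      refine h2.congr' ?_
      filter_upwards [hnorm] with x hx
      rw [Function.comp_apply, hsπ, hx]
    exact one_ne_zero (tendsto_nhds_unique tendsto_const_nhds h3)
  obtain ⟨ε, hε, hsmall⟩ := exists_sub_small_of_not_cauchy 𝒰 (fun x => proj Φ x) (C := 1)
    (hnorm.mono fun _ h => h.le) hnc
  have hJe : J (e0 Φ) ≠ 0 := fun h0 => e0_ne_zero Φ (hJ (h0.trans (map_zero J).symm))
  obtain ⟨U, ⟨hU, hUcl⟩, hUe⟩ := (closed_nhds_basis (0 : Z)).mem_iff.1
    (isOpen_compl_singleton.mem_nhds (show (0 : Z) ∈ {J (e0 Φ)}ᶜ from hJe.symm))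
  -- Choosing `J (z n)` in `V n` keeps small combinations inside the closed set `J ⁻¹' U`, which
  -- misses `e₀`.
  obtain ⟨V, hV, hVU⟩ := exists_seq_sum_mem hU
  obtain ⟨d, hd, hlow⟩ := exists_seq_lower_estimate
    (P := fun n d => ∃ z, proj Φ z = d ∧ J (incl Φ z) ∈ V n) hε (by
      intro n N η hη
      obtain ⟨W, hW, hWb, hWV⟩ := exists_balanced_add_mem (hV n)
      obtain ⟨x, hx, y, hy, hxy, hi⟩ := hsmall _ (hlim hW) N η hη
      refine ⟨_, ⟨x - y, map_sub _ _ _, ?_⟩, hxy, hi⟩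
      rw [map_sub, map_sub]
      exact hWb.sub_mem_of_add_mem hWV hx hy)
  choose z hzd hzV using hd
  obtain ⟨Y₀, hcl, hinf, he⟩ := exists_e0_notMem_of_lower_estimate Φ
    (y := fun n => incl Φ (z n)) (half_pos hε)
    (fun a => by simpa only [quotientMap_incl, hzd] using hlow a) (U := J ⁻¹' U)
    (by
      rw [(hUcl.preimage J.continuous).closure_eq]
      exact fun hmem => hUe hmem rfl) one_pos
    (fun a ha => by
      have h1 := hVU _ hzV a fun n => (abs_apply_le_l1Norm a n).trans ha.le
      have h2 := Finsupp.apply_linearCombination ℝ J.toLinearMap (fun n => incl Φ (z n)) a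
      change J _ ∈ U
      change J _ = _ at h2
      rw [h2]
      exact h1)
  exact he (h Y₀ hcl hinf)

/-- If `J y` is small, then `π y` is small by `exists_norm_proj_lt_one`, so `y` is `c • e₀` plus a
small vector. Applying `J` shows that `c • J e₀` is small; as `J e₀ ≠ 0`, so is `c`. -/
theorem isInducing_of_injective
    (h : ∀ Y₀ : Submodule ℝ (TwistedSum Φ), IsClosed (Y₀ : Set (TwistedSum Φ)) →
      ¬ FiniteDimensional ℝ Y₀ → e0 Φ ∈ Y₀)
    {Z : Type*} [AddCommGroup Z] [Module ℝ Z] [TopologicalSpace Z] [IsTopologicalAddGroup Z]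
    [ContinuousSMul ℝ Z] [T2Space Z] (J : TwistedSum Φ →L[ℝ] Z) (hJ : Function.Injective J) :
    IsInducing J := by
  obtain ⟨V₀, hV₀, hV₀x⟩ := exists_norm_proj_lt_one Φ h J hJ
  obtain ⟨V, hVV₀, hVo, hV⟩ := mem_nhds_iff.1 hV₀
  have hVy : ∀ y, J y ∈ V → ‖quotientMap Φ y‖ ≤ 1 := by
    intro y hy
    by_contra! hlt
    obtain ⟨_, ⟨hx1, hx2⟩, x, rfl⟩ := mem_closure_iff_nhds.1 (denseRange_incl Φ y) _
      (inter_mem ((hVo.preimage J.continuous).mem_nhds hy)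
        ((isOpen_lt continuous_const (quotientMap Φ).continuous.norm).mem_nhds hlt))
    have hx2 : 1 < ‖quotientMap Φ (incl Φ x)‖ := hx2
    rw [quotientMap_incl] at hx2
    exact absurd hx2 (hV₀x x (hVV₀ hx1)).le.not_gt
  rw [IsTopologicalAddGroup.isInducing_iff_nhds_zero]
  refine le_antisymm (by simpa using (J.continuous.tendsto 0).le_comap) fun U hU => ?_
  obtain ⟨U₁, hU₁, -, hU₁U⟩ := exists_balanced_add_mem hU
  obtain ⟨δ, hδ, hδU⟩ := exists_pos_smul_mem hU₁ (e0 Φ)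
  have hJe : δ • J (e0 Φ) ≠ 0 :=
    smul_ne_zero hδ.ne' fun h0 => e0_ne_zero Φ (hJ (h0.trans (map_zero J).symm))
  obtain ⟨W, ⟨hW, hWb⟩, hWe⟩ := (nhds_basis_balanced ℝ Z).mem_iff.1
    (isOpen_compl_singleton.mem_nhds (show (0 : Z) ∈ {δ • J (e0 Φ)}ᶜ from hJe.symm))
  obtain ⟨W₁, hW₁, hW₁b, hW₁W⟩ := exists_balanced_add_mem hW
  obtain ⟨η, hη, hηU⟩ := exists_sub_smul_e0_mem Φ (inter_mem hU₁
    (J.continuous.continuousAt.preimage_mem_nhds (by rwa [map_zero]) : J ⁻¹' W₁ ∈ 𝓝 0))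
  -- The dilation turns the bound `‖π y‖ ≤ 1` on `J ⁻¹' V` into `‖π y‖ ≤ η / 2`.
  have hV' : {z : Z | (2 / η) • z ∈ V} ∈ 𝓝 (0 : Z) := by
    refine (continuous_const_smul (2 / η)).continuousAt.preimage_mem_nhds ?_
    rw [smul_zero]
    exact hVo.mem_nhds hV
  refine ⟨{z | (2 / η) • z ∈ V} ∩ W₁, inter_mem hV' hW₁, ?_⟩
  rintro y ⟨hy1, hy2⟩
  have hyη : ‖quotientMap Φ y‖ < η := by
    have h1 : J ((2 / η) • y) ∈ V := by rw [map_smul]; exact hy1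
    have h2 := hVy _ h1
    rw [map_smul, norm_smul, Real.norm_of_nonneg (by positivity), div_mul_eq_mul_div,
      div_le_one hη] at h2
    have := norm_nonneg (quotientMap Φ y)
    linarith
  obtain ⟨c, hc1, hc2⟩ := hηU y hyη
  have hcJ : c • J (e0 Φ) ∈ W := by
    have := hW₁b.sub_mem_of_add_mem hW₁W hy2 hc2
    rwa [map_sub, map_smul, sub_sub_cancel] at this
  have hc : |c| ≤ δ := by
    by_contra! hlt
    have hc0 : c ≠ 0 := by
      rintro rfl
      rw [abs_zero] at hlt
      linarith
    have h1 := hWb.smul_mem_of_abs_le_one (c := δ / c) (by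
      rw [abs_div, abs_of_pos hδ]
      exact (div_le_one (by linarith)).2 hlt.le) hcJ
    rw [smul_smul, div_mul_cancel₀ _ hc0] at h1
    exact hWe h1 rfl
  have := hU₁U _ hc1 _ (hδU c hc)
  rwa [sub_add_cancel] at this

theorem isTopologicallyMinimal
    (h : ∀ Y₀ : Submodule ℝ (TwistedSum Φ), IsClosed (Y₀ : Set (TwistedSum Φ)) →
      ¬ FiniteDimensional ℝ Y₀ → e0 Φ ∈ Y₀) : IsTopologicallyMinimal (TwistedSum Φ) := by
  let t : TopologicalSpace (TwistedSum Φ) := inferInstance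
  intro τ h1 h2 h3 hle
  -- The identity, from the original topology to the weaker `τ`.
  let J := @ContinuousLinearMap.mk ℝ ℝ _ _ (RingHom.id ℝ) (TwistedSum Φ) t _ (TwistedSum Φ) τ _ _ _
    LinearMap.id (continuous_id_iff_le.2 hle)
  have hJ := @isInducing_of_injective Φ h (TwistedSum Φ) _ _ τ h1 h2 h3 J Function.injective_id
  exact ((@IsInducing.eq_induced _ _ t τ J hJ).trans induced_id).symm

/-- If `T` maps the ball to a set that is not totally bounded, some ultrafilter on that set has a
non-Cauchy image in `ℓ₁`. Differences then give bounded `x n` for which `π (T (x n))` has a lower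
`ℓ₁`-estimate, and continuity of `T` keeps small combinations away from `e₀`. -/
theorem isCompactOperator_of_forall_e0_mem
    (h : ∀ Y₀ : Submodule ℝ (TwistedSum Φ), IsClosed (Y₀ : Set (TwistedSum Φ)) →
      ¬ FiniteDimensional ℝ Y₀ → e0 Φ ∈ Y₀) (T : L1 →L[ℝ] TwistedSum Φ) :
    IsCompactOperator T := by
  by_contra hT
  let B := T '' Metric.closedBall 0 1
  have hB : Bornology.IsVonNBounded ℝ B :=
    (NormedSpace.isVonNBounded_closedBall ℝ L1 1).image T
  have hnt : ¬ TotallyBounded B := fun htb => hT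
    ⟨closure B, htb.closure.isCompact_of_isClosed isClosed_closure,
      mem_of_superset (Metric.closedBall_mem_nhds 0 one_pos)
        fun x hx => subset_closure ⟨x, hx, rfl⟩⟩
  rw [totallyBounded_iff_ultrafilter] at hnt
  push Not at hnt
  obtain ⟨𝒰, h𝒰, hnc⟩ := hnt
  have hB𝒰 : B ∈ 𝒰 := le_principal_iff.1 h𝒰
  have hnc' : ¬ Cauchy (map (fun y => quotientMap Φ y) 𝒰) := fun hC => hnc (by
    simpa using cauchy_of_cauchy_quotientMap Φ 𝒰 id hB hB𝒰 hC)
  obtain ⟨ε, hε, hsmall⟩ := exists_sub_small_of_not_cauchy 𝒰 (fun y => quotientMap Φ y)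
    (C := ‖quotientMap Φ ∘L T‖) (by
      filter_upwards [hB𝒰]
      rintro _ ⟨x, hx, rfl⟩
      exact (quotientMap Φ ∘L T).unit_le_opNorm x (mem_closedBall_zero_iff.1 hx)) hnc'
  obtain ⟨d, hd, hlow⟩ := exists_seq_lower_estimate
    (P := fun _ d => ∃ x : L1, ‖x‖ ≤ 2 ∧ quotientMap Φ (T x) = d) hε (by
      intro n N η hη
      obtain ⟨_, ⟨x, hx, rfl⟩, _, ⟨y, hy, rfl⟩, hxy, hi⟩ := hsmall B hB𝒰 N η hη
      refine ⟨_, ⟨x - y, ?_, by rw [map_sub, map_sub]⟩, hxy, hi⟩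
      rw [mem_closedBall_zero_iff] at hx hy
      linarith [norm_sub_le x y])
  choose x hx hxd using hd
  obtain ⟨U, ⟨hU, hUcl⟩, hUe⟩ := (closed_nhds_basis (0 : TwistedSum Φ)).mem_iff.1
    (isOpen_compl_singleton.mem_nhds (show (0 : TwistedSum Φ) ∈ {e0 Φ}ᶜ from
      (e0_ne_zero Φ).symm))
  obtain ⟨η, hη, hηU⟩ := Metric.nhds_basis_ball.mem_iff.1
    (T.continuous.continuousAt.preimage_mem_nhds (by rwa [map_zero]) : T ⁻¹' U ∈ 𝓝 0)
  obtain ⟨Y₀, hcl, hinf, he⟩ := exists_e0_notMem_of_lower_estimate Φ (y := fun n => T (x n))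
    (half_pos hε) (fun a => by simpa only [hxd] using hlow a)
    -- The radius is `η / 2` because the `x n`, being differences of vectors of the unit ball, have
    -- norm at most `2`.
    (by rw [hUcl.closure_eq]; exact fun hmem => hUe hmem rfl) (half_pos hη)
    (fun a ha => by
      have h2 := Finsupp.apply_linearCombination ℝ T.toLinearMap x a
      change T _ = Finsupp.linearCombination ℝ (fun n => T (x n)) a at h2
      rw [← h2]
      refine hηU (mem_ball_zero_iff.2 ?_)
      have := norm_linearCombination_le hx a
      linarith)
  exact he (h Y₀ hcl hinf)

theorem exists_scalar_add_compact
    (h : ∀ Y₀ : Submodule ℝ (TwistedSum Φ), IsClosed (Y₀ : Set (TwistedSum Φ)) →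
      ¬ FiniteDimensional ℝ Y₀ → e0 Φ ∈ Y₀) (T : TwistedSum Φ →L[ℝ] TwistedSum Φ) :
    ∃ (c : ℝ) (S : TwistedSum Φ →L[ℝ] TwistedSum Φ),
      IsCompactOperator S ∧ T = c • ContinuousLinearMap.id ℝ (TwistedSum Φ) + S := by
  -- The kernel of a continuous functional is closed and has codimension at most one, so it is
  -- infinite-dimensional and contains `e₀`.
  have hfun : ∀ f : TwistedSum Φ →L[ℝ] ℝ, f (e0 Φ) = 0 := by
    intro f
    refine h (LinearMap.ker f.toLinearMap) (isClosed_eq f.continuous continuous_const)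
      fun hfin => ?_
    refine not_finiteDimensional Φ ⟨Submodule.fg_of_fg_map_of_fg_inf_ker f.toLinearMap ?_ ?_⟩
    · exact IsNoetherian.noetherian _
    · rw [top_inf_eq]
      exact Module.Finite.iff_fg.1 hfin
  have hTe : quotientMap Φ (T (e0 Φ)) = 0 := by
    ext i
    exact hfun (lp.evalCLM ℝ (fun _ : ℕ => ℝ) 1 i ∘L quotientMap Φ ∘L T)
  obtain ⟨c, hc⟩ := exists_eq_smul_e0 Φ hTe
  let S := T - c • ContinuousLinearMap.id ℝ (TwistedSum Φ)
  have hSe : S (e0 Φ) = 0 := by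
    change T (e0 Φ) - c • e0 Φ = 0
    rw [hc, sub_self]
  have hSα : ∀ α β u, S (incl Φ (pair Φ α u)) = S (incl Φ (pair Φ β u)) := by
    intro α β u
    have h1 : pair Φ β u = pair Φ α u - (α - β) • pair Φ 1 0 := by
      rw [pair_sub_smul, sub_sub_cancel]
    have h2 : S (incl Φ (pair Φ 1 0)) = 0 := hSe
    rw [h1, map_sub, map_sub, map_smul, map_smul, h2, smul_zero, sub_zero]
  obtain ⟨R, hR⟩ := exists_extend_c00
    (S.toLinearMap ∘ₗ (incl Φ).toLinearMap ∘ₗ zeroPair Φ) fun U hU => by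
      obtain ⟨ε, hε, hεU⟩ := exists_qnorm_lt_mem Φ
        (S.continuous.continuousAt.preimage_mem_nhds (by rwa [map_zero]) : S ⁻¹' U ∈ 𝓝 0)
      refine ⟨ε, hε, fun u hu => ?_⟩
      -- `S` ignores the first component, which may thus be chosen as `Φ u`; the quasinorm then
      -- reduces to `‖u‖₁`.
      have h1 : S (incl Φ (pair Φ (Φ u) u)) ∈ U := hεU _ (by rwa [qnorm_pair_self])
      rwa [hSα _ 0] at h1
  have hSR : S = R ∘L quotientMap Φ := by
    refine DFunLike.ext' ((denseRange_incl Φ).equalizer S.continuous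
      (R ∘L quotientMap Φ).continuous (funext fun x => ?_))
    obtain ⟨α, u, rfl⟩ := exists_eq_pair Φ x
    change S _ = R (quotientMap Φ _)
    rw [quotientMap_incl_pair, hR, hSα α 0]
    rfl
  refine ⟨c, S, ?_, by simp only [S]; abel⟩
  rw [hSR]
  exact (isCompactOperator_of_forall_e0_mem Φ h R).comp_clm (quotientMap Φ)

end TwistedSum

/-! ### The equivalences, with (2) as the hub -/

theorem theorem2p1 (Φ : QuasilinearMap) :
    List.TFAE [
      -- (1) `Y` contains no basic sequence
      ¬ ∃ x : ℕ → TwistedSum Φ, IsBasicSequence x,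
      -- (2) every closed infinite-dimensional subspace of `Y` contains `e₀`
      ∀ Y₀ : Submodule ℝ (TwistedSum Φ), IsClosed (Y₀ : Set (TwistedSum Φ)) →
        ¬ FiniteDimensional ℝ Y₀ → TwistedSum.e0 Φ ∈ Y₀,
      -- (3) the quotient map onto `ℓ₁` is strictly singular
      IsStrictlySingular (TwistedSum.quotientMap Φ),
      -- (4) `Y` is topologically minimal
      IsTopologicallyMinimal (TwistedSum Φ),
      -- (5) `Φ` is not bounded on any infinite-dimensional subspace of `c₀₀`
      ¬ ∃ F : Submodule ℝ (ℕ →₀ ℝ), ¬ FiniteDimensional ℝ F ∧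
        ∃ K : ℝ, ∀ u ∈ F, |Φ u| ≤ K * l1Norm u,
      -- (6) every bounded operator from `ℓ₁` to `Y` is compact
      ∀ T : L1 →L[ℝ] TwistedSum Φ, IsCompactOperator T,
      -- (7) every bounded operator on `Y` is a scalar plus a compact operator
      ∀ T : TwistedSum Φ →L[ℝ] TwistedSum Φ, ∃ (c : ℝ) (S : TwistedSum Φ →L[ℝ] TwistedSum Φ),
        IsCompactOperator S ∧ T = c • ContinuousLinearMap.id ℝ (TwistedSum Φ) + S] := by
  tfae_have 1 → 5 := by
    rintro h ⟨F, hF, K, hK⟩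
    exact h (TwistedSum.exists_isBasicSequence Φ hF hK)
  tfae_have 6 → 5 := by
    rintro h ⟨F, hF, K, hK⟩
    obtain ⟨T, hT⟩ := TwistedSum.exists_not_isCompactOperator Φ hF hK
    exact hT (h T)
  tfae_have 7 → 5 := by
    rintro h ⟨F, hF, K, hK⟩
    obtain ⟨T, hT⟩ := TwistedSum.exists_not_scalar_add_compact Φ hF hK
    exact hT (h T)
  tfae_have 5 → 3 := fun h _ _ hinf hemb =>
    h (TwistedSum.exists_bounded_of_isEmbedding Φ hinf hemb)
  tfae_have 3 → 2 := fun h Y₀ hcl hinf => by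
    by_contra he
    exact h Y₀ hcl hinf (TwistedSum.isEmbedding_quotientMap_of_e0_notMem Φ hcl he)
  tfae_have 2 → 1 := by
    rintro h ⟨x, hx⟩
    obtain ⟨Y₀, hcl, hinf, he⟩ := TwistedSum.exists_e0_notMem_of_isBasicSequence Φ hx
    exact he (h Y₀ hcl hinf)
  tfae_have 4 → 2 := fun h Y₀ hcl hinf => by
    by_contra he
    exact TwistedSum.not_isTopologicallyMinimal Φ hcl hinf he h
  tfae_have 2 → 4 := TwistedSum.isTopologicallyMinimal Φ
  tfae_have 2 → 6 := TwistedSum.isCompactOperator_of_forall_e0_mem Φ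
  tfae_have 2 → 7 := TwistedSum.exists_scalar_add_compact Φ
  tfae_finish
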